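/- **Theorem 1.4.** Fix $d\ge 0$ items and a number of time steps $T\ge 1$. An input stream is a sequence $x=(x^1,\dots,x^T)$ with $x^t\in\{-1,0,1\}^d$; two streams are *(item-level) neighboring* if there is an item $i^*\in[d]$ such that $x_i^t=y_i^t$ for all $t$ and all $i\neq i^*$. A *continual observation algorithm* $A$ is a randomized algorithm whose real output at time $t$ is $a^t=A(x^1,\dots,x^t)$, a function of the first $t$ updates and of the algorithm's internal randomness; $A^T(x)=(a^1,\dots,a^T)$. It is *item-level $(\varepsilon,\delta)$-differentially private* if $\Pr[A^T(x)\in S]\le e^{\varepsilon}\Pr[A^T(y)\in S]+\delta$ for all neighboring $x,y$ and all measurable $S\subseteq\mathbb R^T$, and *item-level $\varepsilon$-differentially private* if this holds with $\delta=0$. Let $Q$ be a real-valued function of finite sequences of updates, and write $Q^t(x)=Q(x^1,\dots,x^t)$, where $Q^0$ is the value at the empty sequence. Suppose that $|Q^t(x)-Q^t(y)|\le 1$ for all neighboring $x,y$ and all $t\in[T]$. Let $K\ge 0$ and $\beta\in(0,1)$. 1. There is a universal constant $C>0$ such that for every such $d,T,Q,K,\beta$ and every $\varepsilon>0$ there is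 an item-level $\varepsilon$-differentially private algorithm with the following property. For every stream $x$ with $\sum_{t=1}^T|Q^t(x)-Q^{t-1}(x)|\le K$, with probability at least $1-\beta$, $$|a^t-Q^t(x)|\le C\cdot\min\Big(K,\ \sqrt{\varepsilon^{-1}K\ln(T/\beta)},\ \varepsilon^{-1}T\ln(T/\beta)\Big)\quad\text{for all } t\in[T]\text{ simultaneously.}$$ 2. For all $\varepsilon_0>0$ and $\delta_0\in(0,1)$ there is a constant $C>0$, depending only on $\varepsilon_0$ and $\delta_0$, such that for every such $d,T,Q,K,\beta$ and all $0<\varepsilon\le\varepsilon_0$, $0<\delta\le\delta_0$ there is an item-level $(\varepsilon,\delta)$-differentially private algorithm with the following property. For every stream $x$ with $\sum_{t=1}^T|Q^t(x)-Q^{t-1}(x)|\le K$, with probability at least $1-\beta$, $$|a^t-Q^t(x)|\le C\cdot\min\Big(K,\ \big(\varepsilon^{-2}K\ln(1/\delta)\ln^2(T/\beta)\big)^{1/3},\ \varepsilon^{-1}\sqrt{T\ln(1/\delta)\ln(T/\beta)}\Big)\quad\text{for all } t\in[T]\text{ simultaneously.}$$ -/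

import Mathlib

open MeasureTheory

/-- The update of one time step: for each of the `d` items a sign, `1` for an insertion,
`-1` for a deletion and `0` for no update, that is, a vector in `{-1, 0, 1} ^ d`. -/
abbrev ItemUpdate (d : ℕ) : Type := Fin d → SignType

/-- An input stream of length `T`. The entry with index `t : Fin T` is the update of time step
`t + 1`. -/
abbrev UpdateStream (d T : ℕ) : Type := Fin T → ItemUpdate d

/-- The sequence of the updates of the time steps `1, …, t` of a stream (for `t ≤ T`). -/
def upToTime {d T : ℕ} (x : UpdateStream d T) (t : ℕ) : List (ItemUpdate d) :=
  (List.ofFn x).take t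

/-- Item-level neighboring streams: they agree, at all times, on all items but one. -/
def ItemNeighboring {d T : ℕ} (x y : UpdateStream d T) : Prop :=
  ∃ i : Fin d, ∀ t : Fin T, ∀ j : Fin d, j ≠ i → x t j = y t j

/-- The value `Q ^ t (x) = Q (x ^ 1, …, x ^ t)`. For `t = 0` it is the value at the empty stream. -/
def valueAt {d T : ℕ} (Q : List (ItemUpdate d) → ℝ) (x : UpdateStream d T) (t : ℕ) : ℝ :=
  Q (upToTime x t)

/-- At each time step the value of `Q` changes by at most `1` between item-level neighboring
streams. -/
def HasUnitItemSensitivity {d : ℕ} (T : ℕ) (Q : List (ItemUpdate d) → ℝ) : Prop :=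
  ∀ x y : UpdateStream d T, ItemNeighboring x y →
    ∀ t ∈ Finset.Icc 1 T, |valueAt Q x t - valueAt Q y t| ≤ 1

/-- The total variation over time of `Q` along the stream `x`. -/
def timeVariation {d T : ℕ} (Q : List (ItemUpdate d) → ℝ) (x : UpdateStream d T) : ℝ :=
  ∑ t ∈ Finset.Icc 1 T, |valueAt Q x t - valueAt Q x (t - 1)|

/-- A randomized algorithm with real outputs in the continual observation model: it has a source
of randomness, and its output at time `t` is a function of the updates of the time steps
`1, …, t` and of the randomness. -/
structure ContinualAlgorithm (d : ℕ) where
  /-- the space of random seeds -/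
  Seed : Type
  /-- its events -/
  events : MeasurableSpace Seed
  /-- the distribution of the seed -/
  law : Measure Seed
  /-- the seed is drawn from a probability distribution -/
  isProbability : IsProbabilityMeasure law
  /-- the output after a sequence of updates -/
  output : List (ItemUpdate d) → Seed → ℝ
  /-- outputs are random variables -/
  measurable_output : ∀ u, Measurable (output u)

/-- The sequence of the outputs at all time steps `1, …, T` on the stream `x`. -/
def ContinualAlgorithm.transcript {d T : ℕ} (A : ContinualAlgorithm d) (x : UpdateStream d T)
    (ω : A.Seed) : Fin T → ℝ :=
  fun t => A.output (upToTime x (t + 1)) ω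

/-- The probability, over the randomness of the algorithm, of an event. -/
noncomputable def ContinualAlgorithm.pr {d : ℕ} (A : ContinualAlgorithm d) (E : Set A.Seed) : ℝ :=
  (@Measure.real A.Seed A.events A.law E)

/-- Item-level `(ε, δ)`-differential privacy, for streams of length `T`, of the sequence of all
outputs. -/
def ContinualAlgorithm.IsItemDP {d : ℕ} (A : ContinualAlgorithm d) (T : ℕ) (ε δ : ℝ) : Prop :=
  ∀ x y : UpdateStream d T, ItemNeighboring x y →
    ∀ S : Set (Fin T → ℝ), MeasurableSet S →
      A.pr {ω | A.transcript x ω ∈ S} ≤ Real.exp ε * A.pr {ω | A.transcript y ω ∈ S} + δ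

/-- On the stream `x`, with probability at least `1 - β`, the outputs at all time steps
simultaneously differ from the values of `Q` by at most `α`. -/
def ContinualAlgorithm.HasErrorAtMost {d T : ℕ} (A : ContinualAlgorithm d)
    (Q : List (ItemUpdate d) → ℝ) (x : UpdateStream d T) (α β : ℝ) : Prop :=
  1 - β ≤ A.pr {ω | ∀ t : Fin T, |A.transcript x ω t - valueAt Q x (t + 1)| ≤ α}

open ProbabilityTheory
open scoped ENNReal NNReal

/-! Write `L = ln (T / β)` and `D = ln (1 / δ)`. Each term of the minimum is the error of one
algorithm, and the parameters alone decide which to run. The constant `Q []` has error at most `K`.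
Independent noise on each of the `T` values gives the last term: Laplace of rate `ε / T` in the pure
case, Gaussian of variance `4 D T / ε ^ 2` in the approximate one.

The middle term comes from a tracking algorithm. It keeps an estimate and searches, by the sparse
vector technique, for the first time at which the noisy error exceeds a noisy threshold `τ`; it then
moves the estimate by exactly `τ` in the detected direction and searches again, for at most `n`
phases. The outputs are functions of the halting indices, so only these need protection. A phase
with Laplace noise of rate `η` is `3 η`-private however many queries it asks
(`measureReal_haltingIndex_le`), and composition over `n` phases costs `3 n η`
(`phaseHistory_pure_composition`) or order `η √(n D)` (`phaseHistory_approx_composition`).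

Accuracy is a potential argument (`error_add_mul_le_variation`). If all noises are at most `B` and
`τ = 8 B`, each move lowers the error by at least `4 B`, while only the variation of `Q` raises it.
Thus `n > K / (4 B)` phases outlast the stream, and the error stays below `10 B` with `B` of order
`L / η`. Balancing `n` of order `K η / L` against the privacy budget gives `√(K L / ε)` and `(K D L
^ 2 / ε ^ 2) ^ (1 / 3)`. -/

/-! ### Densities of translated product measures -/

theorem map_add_withDensity {f : ℝ → ℝ} (hf : Measurable f) (hpos : ∀ x, 0 < f x) (v : ℝ) :
    (volume.withDensity fun x => ENNReal.ofReal (f x)).map (fun x => x + v) =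
      (volume.withDensity fun x => ENNReal.ofReal (f x)).withDensity
        fun x => ENNReal.ofReal (f (x - v) / f x) := by
  have hm : Measurable fun x => ENNReal.ofReal (f x) := hf.ennreal_ofReal
  have hm' : Measurable fun x => ENNReal.ofReal (f (x - v) / f x) := by fun_prop
  ext A hA
  rw [Measure.map_apply (by fun_prop) hA, withDensity_apply _ (hA.preimage (by fun_prop)),
    withDensity_apply _ hA, restrict_withDensity hA, lintegral_withDensity_eq_lintegral_mul _ hm hm',
    ← lintegral_indicator (hA.preimage (by fun_prop)), ← lintegral_indicator hA,
    ← lintegral_sub_right_eq_self _ v]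
  refine lintegral_congr fun x => ?_
  have hx : x - v ∈ (fun x => x + v) ⁻¹' A ↔ x ∈ A := by simp
  by_cases hxA : x ∈ A
  · rw [Set.indicator_of_mem hxA, Set.indicator_of_mem (hx.mpr hxA), Pi.mul_apply,
      ← ENNReal.ofReal_mul (hpos x).le, mul_div_cancel₀ _ (hpos x).ne']
  · rw [Set.indicator_of_notMem hxA, Set.indicator_of_notMem (mt hx.mp hxA)]

theorem lintegral_pi_prod {ι : Type*} [Fintype ι] (μ : Measure ℝ) [IsProbabilityMeasure μ]
    {g : ι → ℝ → ℝ≥0∞} (hg : ∀ i, Measurable (g i)) :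
    ∫⁻ x, ∏ i, g i (x i) ∂(Measure.pi fun _ : ι => μ) = ∏ i, ∫⁻ y, g i y ∂μ := by
  have h := iIndepFun_pi (μ := fun _ : ι => μ) (X := g) (fun i => (hg i).aemeasurable)
  rw [lintegral_prod_eq_prod_lintegral_of_indepFun Finset.univ _ h
    (fun i => (hg i).comp (measurable_pi_apply i))]
  refine Finset.prod_congr rfl fun i _ => ?_
  exact (measurePreserving_eval (fun _ : ι => μ) i).lintegral_comp (hg i)

/-- A density for the translate of a product measure. -/
theorem pi_map_add_eq_withDensity {ι : Type*} [Fintype ι] (μ : Measure ℝ) [IsProbabilityMeasure μ]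
    {g : ι → ℝ → ℝ≥0∞} (hg : ∀ i, Measurable (g i)) {v : ι → ℝ}
    (h : ∀ i, μ.map (fun x => x + v i) = μ.withDensity (g i)) :
    (Measure.pi fun _ : ι => μ).map (fun x => x + v) =
      (Measure.pi fun _ : ι => μ).withDensity fun x => ∏ i, g i (x i) := by
  have hp : ∀ i, IsProbabilityMeasure (μ.map (fun x => x + v i)) := fun i =>
    Measure.isProbabilityMeasure_map (by fun_prop)
  have h1 : (Measure.pi fun _ : ι => μ).map (fun x => x + v) =
      Measure.pi fun i => μ.map (fun x => x + v i) :=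
    Measure.pi_map_pi (f := fun i x => x + v i) (fun i => by fun_prop)
  rw [h1]
  refine Measure.pi_eq fun s hs => ?_
  rw [withDensity_apply _ (MeasurableSet.univ_pi hs), ← lintegral_indicator (MeasurableSet.univ_pi hs)]
  have h2 : ∀ x : ι → ℝ, (Set.univ.pi s).indicator (fun x => ∏ i, g i (x i)) x =
      ∏ i, (s i).indicator (g i) (x i) := by
    intro x
    by_cases hx : x ∈ Set.univ.pi s
    · rw [Set.indicator_of_mem hx]
      exact Finset.prod_congr rfl fun i _ => (Set.indicator_of_mem (hx i trivial) _).symm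
    · rw [Set.indicator_of_notMem hx]
      simp only [Set.mem_pi, not_forall] at hx
      obtain ⟨i, -, hi⟩ := hx
      exact (Finset.prod_eq_zero (Finset.mem_univ i) (Set.indicator_of_notMem hi _)).symm
  simp_rw [h2]
  rw [lintegral_pi_prod μ fun i => (hg i).indicator (hs i)]
  refine Finset.prod_congr rfl fun i _ => ?_
  rw [lintegral_indicator (hs i), h i, withDensity_apply _ (hs i)]

/-! ### Laplace noise -/

/-- The density of the centred Laplace distribution with rate `η`. -/
noncomputable def laplaceDensity (η x : ℝ) : ℝ := η / 2 * Real.exp (-η * |x|)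

/-- The centred Laplace distribution with rate `η`. -/
noncomputable def laplaceMeasure (η : ℝ) : Measure ℝ :=
  volume.withDensity fun x => ENNReal.ofReal (laplaceDensity η x)

theorem measurable_laplaceDensity (η : ℝ) : Measurable (laplaceDensity η) := by
  unfold laplaceDensity; fun_prop

theorem laplaceDensity_pos {η : ℝ} (hη : 0 < η) (x : ℝ) : 0 < laplaceDensity η x := by
  unfold laplaceDensity; positivity

theorem integrable_laplaceDensity {η : ℝ} (hη : 0 < η) : Integrable (laplaceDensity η) := by
  -- A function that is not integrable has Bochner integral `0`, so a nonzero integral suffices.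
  refine not_imp_comm.1 integral_undef (ne_of_gt ?_)
  unfold laplaceDensity
  rw [integral_comp_abs (f := fun y => η / 2 * Real.exp (-η * y)), integral_const_mul,
    integral_exp_mul_Ioi (by linarith)]
  rw [mul_zero, Real.exp_zero]
  have : 0 < η⁻¹ := inv_pos.mpr hη
  rw [neg_div_neg_eq, one_div]
  positivity

theorem laplaceMeasure_apply {η : ℝ} (hη : 0 < η) {A : Set ℝ} (hA : MeasurableSet A) :
    laplaceMeasure η A = ENNReal.ofReal (∫ x, A.indicator (laplaceDensity η) x) := by
  rw [laplaceMeasure, withDensity_apply _ hA, integral_indicator hA,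
    ofReal_integral_eq_lintegral_ofReal (integrable_laplaceDensity hη).integrableOn
      (Filter.Eventually.of_forall fun x => (laplaceDensity_pos hη x).le)]

theorem laplaceMeasure_abs_gt {η u : ℝ} (hη : 0 < η) (hu : 0 ≤ u) :
    laplaceMeasure η {x | u < |x|} = ENNReal.ofReal (Real.exp (-η * u)) := by
  rw [laplaceMeasure_apply hη (measurableSet_lt measurable_const (by fun_prop))]
  congr 1
  have h1 : ∀ x : ℝ, {x : ℝ | u < |x|}.indicator (laplaceDensity η) x =
      (Set.Ioi u).indicator (fun y => η / 2 * Real.exp (-η * y)) |x| := by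
    intro x
    simp only [Set.indicator, Set.mem_ofPred_eq, Set.mem_Ioi, laplaceDensity]
  simp_rw [h1]
  rw [integral_comp_abs, setIntegral_indicator measurableSet_Ioi, Set.Ioi_inter_Ioi,
    sup_of_le_right hu, integral_const_mul, integral_exp_mul_Ioi (by linarith)]
  field_simp

/-- The total mass is the tail at `0`, since the origin is not an atom. -/
theorem isProbabilityMeasure_laplaceMeasure {η : ℝ} (hη : 0 < η) :
    IsProbabilityMeasure (laplaceMeasure η) := by
  refine ⟨?_⟩
  have h0 : laplaceMeasure η {0} = 0 := by
    simp [laplaceMeasure]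
  have h1 : (Set.univ : Set ℝ) = {x | 0 < |x|} ∪ {0} := by
    ext x; by_cases hx : x = 0 <;> simp [hx]
  have h2 := laplaceMeasure_abs_gt hη le_rfl
  refine le_antisymm ?_ ?_
  · rw [h1]; exact (measure_union_le _ _).trans (by rw [h2, h0]; simp)
  · exact le_trans (by rw [h2]; simp) (measure_mono (Set.subset_univ {x : ℝ | 0 < |x|}))

/-- Translating a vector of independent Laplace variables with rate `η` by `v` changes
probabilities at most by the factor `exp (η * ‖v‖₁)`. -/
theorem laplace_pi_translate_le {ι : Type*} [Fintype ι] {η : ℝ} (hη : 0 < η) (v : ι → ℝ)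
    {A : Set (ι → ℝ)} (hA : MeasurableSet A) :
    (Measure.pi fun _ : ι => laplaceMeasure η) {ω | ω + v ∈ A} ≤
      ENNReal.ofReal (Real.exp (η * ∑ i, |v i|)) * (Measure.pi fun _ : ι => laplaceMeasure η) A := by
  have := isProbabilityMeasure_laplaceMeasure hη
  have h := pi_map_add_eq_withDensity (laplaceMeasure η)
    (g := fun i x => ENNReal.ofReal (laplaceDensity η (x - v i) / laplaceDensity η x))
    (fun i => by have := measurable_laplaceDensity η; fun_prop) (v := v)
    (fun i => map_add_withDensity (measurable_laplaceDensity η) (laplaceDensity_pos hη) (v i))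
  have h1 : (Measure.pi fun _ : ι => laplaceMeasure η) {ω | ω + v ∈ A} =
      (Measure.pi fun _ : ι => laplaceMeasure η).map (fun x => x + v) A :=
    (Measure.map_apply (by fun_prop) hA).symm
  rw [h1, h, withDensity_apply _ hA, ← setLIntegral_const]
  refine lintegral_mono fun x => ?_
  rw [← ENNReal.ofReal_prod_of_nonneg fun i _ =>
    (div_pos (laplaceDensity_pos hη _) (laplaceDensity_pos hη _)).le]
  refine ENNReal.ofReal_le_ofReal ?_
  rw [Finset.mul_sum, Real.exp_sum]
  refine Finset.prod_le_prod
    (fun i _ => (div_pos (laplaceDensity_pos hη _) (laplaceDensity_pos hη _)).le) fun i _ => ?_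
  rw [div_le_iff₀ (laplaceDensity_pos hη _)]
  unfold laplaceDensity
  rw [mul_left_comm, ← Real.exp_add]
  gcongr
  have h2 : |x i| ≤ |x i - v i| + |v i| := by
    simpa using abs_add_le (x i - v i) (v i)
  nlinarith

/-! ### Gaussian noise and moments of the privacy loss -/

/-- Here `ℓ` is the privacy loss, so the left side is the probability of `A` under the other law.
Pointwise `exp ℓ ≤ exp ε + exp (-l ε) exp ((1 + l) ℓ)`: the first term dominates where `ℓ ≤ ε`, the
second elsewhere. -/
theorem setLIntegral_exp_le_of_moment {Ω : Type*} [MeasurableSpace Ω] (μ : Measure Ω)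
    {ℓ : Ω → ℝ} {l ε δ : ℝ} (hl : 0 ≤ l) (hℓ : Measurable ℓ)
    (h : ∫⁻ ω, ENNReal.ofReal (Real.exp ((1 + l) * ℓ ω)) ∂μ ≤
      ENNReal.ofReal (Real.exp (l * ε) * δ)) (A : Set Ω) :
    ∫⁻ ω in A, ENNReal.ofReal (Real.exp (ℓ ω)) ∂μ ≤
      ENNReal.ofReal (Real.exp ε) * μ A + ENNReal.ofReal δ := by
  have h1 : ∀ ω, ENNReal.ofReal (Real.exp (ℓ ω)) ≤ ENNReal.ofReal (Real.exp ε) +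
      ENNReal.ofReal (Real.exp (-(l * ε))) * ENNReal.ofReal (Real.exp ((1 + l) * ℓ ω)) := by
    intro ω
    rw [← ENNReal.ofReal_mul (Real.exp_pos _).le, ← ENNReal.ofReal_add (by positivity) (by positivity),
      ← Real.exp_add]
    refine ENNReal.ofReal_le_ofReal ?_
    rcases le_total (ℓ ω) ε with h | h
    · exact (Real.exp_le_exp.mpr h).trans (le_add_of_nonneg_right (Real.exp_pos _).le)
    · refine le_trans ?_ (le_add_of_nonneg_left (Real.exp_pos _).le)
      exact Real.exp_le_exp.mpr (by nlinarith)
  refine (lintegral_mono h1).trans ?_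
  rw [lintegral_add_left measurable_const, setLIntegral_const, lintegral_const_mul _ (by fun_prop)]
  gcongr
  refine (mul_le_mul_right (setLIntegral_le_lintegral _ _) _).trans
    ((mul_le_mul_right h _).trans_eq ?_)
  rw [← ENNReal.ofReal_mul (Real.exp_pos _).le, ← mul_assoc, ← Real.exp_add]
  simp

theorem lintegral_exp_mul_gaussianReal (v : ℝ≥0) (a b : ℝ) :
    ∫⁻ x, ENNReal.ofReal (Real.exp (a * x + b)) ∂(gaussianReal 0 v) =
      ENNReal.ofReal (Real.exp (v * a ^ 2 / 2 + b)) := by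
  have h1 : ∀ x, Real.exp (a * x + b) = Real.exp b * Real.exp (a * x) := fun x => by
    rw [← Real.exp_add, add_comm]
  simp_rw [h1]
  rw [← ofReal_integral_eq_lintegral_ofReal ((integrable_exp_mul_gaussianReal a).const_mul _)
    (Filter.Eventually.of_forall fun x => by positivity), integral_const_mul]
  have := congrFun (mgf_fun_id_gaussianReal (μ := 0) (v := v)) a
  rw [mgf] at this
  rw [this, ← Real.exp_add]
  congr 2; ring

/-- The Gaussian mechanism. -/
theorem gaussian_pi_translate_le {ι : Type*} [Fintype ι] {σ : ℝ≥0} {ε D : ℝ} (hε : 0 < ε)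
    (hεD : ε ≤ 2 * D) (hσ : 0 < σ) (hσ' : 4 * D * Fintype.card ι ≤ ε ^ 2 * σ)
    {v : ι → ℝ} (hv : ∀ i, |v i| ≤ 1) {A : Set (ι → ℝ)} (hA : MeasurableSet A) :
    (Measure.pi fun _ : ι => gaussianReal 0 σ) {ω | ω + v ∈ A} ≤
      ENNReal.ofReal (Real.exp ε) * (Measure.pi fun _ : ι => gaussianReal 0 σ) A +
        ENNReal.ofReal (Real.exp (-D)) := by
  have hσ0 : (0 : ℝ) < σ := hσ
  -- With `l ε = 2 D` it is enough that the moment is at most `exp D`, since `exp D = exp (l ε) exp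
  -- (-D)`.
  set l : ℝ := 2 * D / ε with hl
  have hl1 : 1 ≤ l := by rw [hl, le_div_iff₀ hε]; linarith
  -- The log-likelihood ratio of the laws with means `v i` and `0`; `σ` is the variance.
  set e : ι → ℝ → ℝ := fun i x => (2 * x * v i - v i ^ 2) / (2 * σ) with he
  have hem : ∀ i, Measurable (e i) := fun i => by simp only [he]; fun_prop
  have h := pi_map_add_eq_withDensity (gaussianReal 0 σ)
    (g := fun i x => ENNReal.ofReal (Real.exp (e i x))) (fun i => by have := hem i; fun_prop) (v := v)
    (fun i => by
      rw [gaussianReal_of_var_ne_zero _ hσ.ne']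
      unfold gaussianPDF
      rw [map_add_withDensity (measurable_gaussianPDFReal 0 σ)
        (fun x => gaussianPDFReal_pos 0 σ x hσ.ne')]
      congr 1
      funext x
      congr 1
      rw [div_eq_iff (gaussianPDFReal_pos 0 σ x hσ.ne').ne']
      unfold gaussianPDFReal
      rw [mul_left_comm, ← Real.exp_add]
      congr 2
      simp only [he]
      field_simp
      ring)
  have h1 : (Measure.pi fun _ : ι => gaussianReal 0 σ) {ω | ω + v ∈ A} =
      (Measure.pi fun _ : ι => gaussianReal 0 σ).map (fun x => x + v) A :=
    (Measure.map_apply (by fun_prop) hA).symm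
  have hprod : ∀ x : ι → ℝ, ∏ i, ENNReal.ofReal (Real.exp (e i (x i))) =
      ENNReal.ofReal (Real.exp (∑ i, e i (x i))) := fun x => by
    rw [← ENNReal.ofReal_prod_of_nonneg fun i _ => (Real.exp_pos _).le, Real.exp_sum]
  rw [h1, h, withDensity_apply _ hA]
  simp_rw [hprod]
  refine setLIntegral_exp_le_of_moment _ (l := l) (by linarith) (by fun_prop) ?_ A
  have h2 : ∀ x : ι → ℝ, ENNReal.ofReal (Real.exp ((1 + l) * ∑ i, e i (x i))) =
      ∏ i, ENNReal.ofReal (Real.exp (((1 + l) * v i / σ) * x i + -((1 + l) * v i ^ 2 / (2 * σ)))) := by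
    intro x
    rw [← ENNReal.ofReal_prod_of_nonneg fun i _ => (Real.exp_pos _).le, ← Real.exp_sum,
      Finset.mul_sum]
    congr 2
    refine Finset.sum_congr rfl fun i _ => ?_
    simp only [he]
    field_simp
    ring
  simp_rw [h2]
  rw [lintegral_pi_prod (gaussianReal 0 σ)
    (g := fun i y => ENNReal.ofReal
      (Real.exp (((1 + l) * v i / σ) * y + -((1 + l) * v i ^ 2 / (2 * σ)))))
    (fun i => by fun_prop)]
  simp_rw [lintegral_exp_mul_gaussianReal]
  rw [← ENNReal.ofReal_prod_of_nonneg fun i _ => (Real.exp_pos _).le, ← Real.exp_sum,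
    ← Real.exp_add]
  refine ENNReal.ofReal_le_ofReal (Real.exp_le_exp.mpr ?_)
  have h3 : ∀ i ∈ Finset.univ, σ * ((1 + l) * v i / σ) ^ 2 / 2 + -((1 + l) * v i ^ 2 / (2 * σ)) ≤
      l ^ 2 / σ := by
    intro i _
    have hv2 : v i ^ 2 ≤ 1 := by rw [sq_le_one_iff_abs_le_one]; exact hv i
    have : σ * ((1 + l) * v i / σ) ^ 2 / 2 + -((1 + l) * v i ^ 2 / (2 * σ)) =
        (l * (1 + l) / 2 * v i ^ 2) / σ := by field_simp; ring
    rw [this]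
    gcongr
    nlinarith [mul_le_mul_of_nonneg_left hv2 (show 0 ≤ l * (1 + l) / 2 by positivity)]
  refine (Finset.sum_le_sum h3).trans ?_
  rw [Finset.sum_const, Finset.card_univ, nsmul_eq_mul]
  have hle : l * ε = 2 * D := by rw [hl]; field_simp
  have h4 : Fintype.card ι * (l ^ 2 / σ) ≤ D := by
    rw [mul_div_assoc', div_le_iff₀ hσ0]
    have hD : 0 < D := by linarith
    have h5 : (Fintype.card ι * l ^ 2) * ε ^ 2 ≤ (D * σ) * ε ^ 2 := by
      have : (Fintype.card ι * l ^ 2) * ε ^ 2 = Fintype.card ι * (2 * D) ^ 2 := by rw [← hle]; ring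
      rw [this]; nlinarith
    exact le_of_mul_le_mul_right h5 (by positivity)
  linarith

/-! ### Adaptive composition of mechanisms with finitely many outcomes -/

section Composition

variable {K Ω : Type*}

/-- The outcomes, most recent first, of the first `n` phases of a mechanism whose phases depend on
the earlier outcomes and on independent seeds. -/
def phaseHistory (k : List K → Ω → K) (ω : ℕ → Ω) : ℕ → List K
  | 0 => []
  | n + 1 => k (phaseHistory k ω n) (ω n) :: phaseHistory k ω n

/-- The probability of a sequence of outcomes, given the transition probabilities. -/
def historyWeight (p : List K → K → ℝ) : List K → ℝ
  | [] => 1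
  | a :: w => p w a * historyWeight p w

/-- The logarithm of the likelihood ratio of a sequence of outcomes. -/
noncomputable def historyLoss (p q : List K → K → ℝ) : List K → ℝ
  | [] => 0
  | a :: w => Real.log (p w a / q w a) + historyLoss p q w

/-- The lists of length `n`. -/
def listsOfLength (K : Type*) [Fintype K] : ℕ → Finset (List K)
  | 0 => {[]}
  | n + 1 => (Finset.univ ×ˢ listsOfLength K n).map
      ⟨fun x => x.1 :: x.2, fun x y h => by simpa [Prod.ext_iff] using h⟩

theorem mem_listsOfLength [Fintype K] (n : ℕ) (w : List K) :
    w ∈ listsOfLength K n ↔ w.length = n := by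
  induction n generalizing w with
  | zero => simp [listsOfLength]
  | succ n ih =>
    cases w with
    | nil => simp [listsOfLength]
    | cons a w =>
      simp only [listsOfLength, Finset.mem_map, Finset.mem_product, Finset.mem_univ, true_and, ih,
        Prod.exists, List.length_cons, Nat.add_right_cancel_iff]
      constructor
      · rintro ⟨b, u, hu, h⟩
        exact (List.cons.inj h).2 ▸ hu
      · exact fun h => ⟨a, w, h, rfl⟩

theorem sum_listsOfLength_succ [Fintype K] (n : ℕ) (f : List K → ℝ) :
    ∑ w ∈ listsOfLength K (n + 1), f w = ∑ w ∈ listsOfLength K n, ∑ a, f (a :: w) := by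
  rw [listsOfLength, Finset.sum_map, Finset.sum_product_right]
  rfl

theorem phaseHistory_length (k : List K → Ω → K) (ω : ℕ → Ω) (n : ℕ) :
    (phaseHistory k ω n).length = n := by
  induction n with
  | zero => rfl
  | succ n ih => simp [phaseHistory, ih]

theorem historyWeight_nonneg {p : List K → K → ℝ} (hp : ∀ w a, 0 ≤ p w a) (w : List K) :
    0 ≤ historyWeight p w := by
  induction w with
  | nil => exact zero_le_one
  | cons a w ih => exact mul_nonneg (hp w a) ih

theorem historyWeight_le_pow {p q : List K → K → ℝ} {e : ℝ}
    (hp : ∀ w a, 0 ≤ p w a) (hq : ∀ w a, 0 ≤ q w a) (h : ∀ w a, p w a ≤ Real.exp e * q w a)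
    (w : List K) : historyWeight p w ≤ Real.exp (w.length * e) * historyWeight q w := by
  induction w with
  | nil => simp [historyWeight]
  | cons a w ih =>
    calc p w a * historyWeight p w
        ≤ (Real.exp e * q w a) * (Real.exp (w.length * e) * historyWeight q w) :=
          mul_le_mul (h w a) ih (historyWeight_nonneg hp w)
            (mul_nonneg (Real.exp_pos _).le (hq w a))
      _ = Real.exp ((a :: w).length * e) * (q w a * historyWeight q w) := by
          rw [List.length_cons, Nat.cast_add_one, add_mul, one_mul, Real.exp_add]; ring

/-- The two-sided bound makes `x` and `y` vanish together, so the value of `log (x / y)` at a zero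
denominator does no harm. -/
theorem eq_exp_log_div_mul {x y e : ℝ} (hx : 0 ≤ x) (hy : 0 ≤ y) (h : x ≤ Real.exp e * y)
    (h' : y ≤ Real.exp e * x) : x = Real.exp (Real.log (x / y)) * y := by
  rcases hy.eq_or_lt with rfl | hy
  · have : x ≤ 0 := by simpa using h
    simp [le_antisymm this hx]
  · have hx' : 0 < x := by
      refine hx.lt_of_ne fun h0 => ?_
      rw [← h0, mul_zero] at h'
      linarith
    rw [Real.exp_log (div_pos hx' hy), div_mul_cancel₀ _ hy.ne']

theorem historyWeight_eq_exp_mul {p q : List K → K → ℝ} {e : ℝ}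
    (hp : ∀ w a, 0 ≤ p w a) (hq : ∀ w a, 0 ≤ q w a) (h : ∀ w a, p w a ≤ Real.exp e * q w a)
    (h' : ∀ w a, q w a ≤ Real.exp e * p w a) (w : List K) :
    historyWeight p w = Real.exp (historyLoss p q w) * historyWeight q w := by
  induction w with
  | nil => simp [historyWeight, historyLoss]
  | cons a w ih =>
    rw [historyWeight, historyLoss, historyWeight, ih, Real.exp_add]
    conv_lhs => rw [eq_exp_log_div_mul (hp w a) (hq w a) (h w a) (h' w a)]
    ring

/-- A bound for the exponential moments of the privacy loss of a pure mechanism. -/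
theorem sum_mul_exp_log_div_le [Fintype K] {x y : K → ℝ} {e l : ℝ} (he : 0 ≤ e) (hl : 0 ≤ l)
    (hx : ∀ a, 0 ≤ x a) (hy : ∀ a, 0 ≤ y a) (hx1 : ∑ a, x a = 1) (hy1 : ∑ a, y a = 1)
    (h : ∀ a, x a ≤ Real.exp e * y a) (h' : ∀ a, y a ≤ Real.exp e * x a) :
    ∑ a, x a * Real.exp (l * Real.log (x a / y a)) ≤ Real.exp ((l + 1 / 2) ^ 2 * e ^ 2 / 2) := by
  rcases he.eq_or_lt with rfl | he
  · have hxy : ∀ a, x a = y a := fun a =>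
      le_antisymm (by simpa using h a) (by simpa using h' a)
    have : ∀ a, x a * Real.exp (l * Real.log (x a / y a)) ≤ x a := fun a => by
      rw [hxy a]
      rcases eq_or_ne (y a) 0 with h0 | h0
      · simp [h0]
      · simp [div_self h0]
    refine (Finset.sum_le_sum fun a _ => this a).trans ?_
    rw [hx1]; simp
  set b := Real.exp e with hb
  have hb1 : 1 < b := Real.one_lt_exp_iff.mpr he
  have hb0 : 0 < b := by linarith
  have hbi : b⁻¹ < 1 := inv_lt_one_of_one_lt₀ hb1
  have hlt : b⁻¹ < b := hbi.trans hb1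
  have hexp : Real.log b = e := by rw [hb, Real.log_exp]
  -- The ratio `x a / y a` lies in `[b⁻¹, b]`, where the convex function `r ^ (1 + l)` is below its
  -- chord. The worst case is thus a ratio with only the two extreme values.
  have hconv := convexOn_rpow (p := 1 + l) (by linarith)
  have key : ∀ a, x a * Real.exp (l * Real.log (x a / y a)) ≤
      (x a - b⁻¹ * y a) / (b - b⁻¹) * b ^ (1 + l) + (b * y a - x a) / (b - b⁻¹) * b⁻¹ ^ (1 + l) := by
    intro a
    rcases (hy a).eq_or_lt with h0 | h0
    · have : x a ≤ 0 := by simpa [← h0] using h a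
      have hx0 := le_antisymm this (hx a)
      simp [hx0, ← h0]
    · have hxa : 0 < x a := by
        refine (hx a).lt_of_ne fun hc => ?_
        have := h' a
        rw [← hc, mul_zero] at this
        linarith
      have hd : 0 < b - b⁻¹ := by linarith
      have hu0 : 0 < x a / y a := div_pos hxa h0
      have hub : x a / y a ≤ b := (div_le_iff₀ h0).mpr (h a)
      have hua : b⁻¹ ≤ x a / y a := by
        rw [le_div_iff₀ h0, inv_mul_le_iff₀ hb0]; exact h' a
      have h1 := hconv.2 (Set.mem_Ici.mpr hb0.le) (Set.mem_Ici.mpr (inv_pos.mpr hb0).le)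
        (show 0 ≤ (x a / y a - b⁻¹) / (b - b⁻¹) from div_nonneg (by linarith) hd.le)
        (show 0 ≤ (b - x a / y a) / (b - b⁻¹) from div_nonneg (by linarith) hd.le)
        (by rw [← add_div, sub_add_sub_cancel', div_self hd.ne'])
      have h2 : ((x a / y a - b⁻¹) / (b - b⁻¹)) • b + ((b - x a / y a) / (b - b⁻¹)) • b⁻¹ =
          x a / y a := by
        simp only [smul_eq_mul]
        have : (b - b⁻¹) ≠ 0 := hd.ne'
        rw [div_mul_eq_mul_div, div_mul_eq_mul_div, ← add_div, div_eq_iff this]; ring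
      rw [h2] at h1
      have h3 : x a * Real.exp (l * Real.log (x a / y a)) = y a * (x a / y a) ^ (1 + l) := by
        rw [Real.rpow_add hu0, Real.rpow_one, Real.rpow_def_of_pos hu0, mul_comm l]
        field_simp
      rw [h3]
      refine (mul_le_mul_of_nonneg_left h1 h0.le).trans_eq ?_
      simp only [smul_eq_mul]
      field_simp
  refine (Finset.sum_le_sum fun a _ => key a).trans ?_
  rw [Finset.sum_add_distrib, ← Finset.sum_mul, ← Finset.sum_mul, ← Finset.sum_div,
    ← Finset.sum_div, Finset.sum_sub_distrib, Finset.sum_sub_distrib, ← Finset.mul_sum,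
    ← Finset.mul_sum, hx1, hy1]
  -- The mean of `x / y` under `y` is `1`, which fixes the total weights of the two endpoints.
  have hw1 : (1 - b⁻¹ * 1) / (b - b⁻¹) = 1 / (1 + b) := by
    rw [div_eq_div_iff (by linarith) (by linarith)]; field_simp; ring
  have hw2 : (b * 1 - 1) / (b - b⁻¹) = b / (1 + b) := by
    rw [div_eq_div_iff (by linarith) (by linarith)]; field_simp; ring
  rw [hw1, hw2]
  have hp1 : b ^ (1 + l) = Real.exp (e / 2) * Real.exp ((l + 1 / 2) * e) := by
    rw [Real.rpow_def_of_pos hb0, hexp, ← Real.exp_add]; congr 1; ring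
  have hp2 : b * b⁻¹ ^ (1 + l) = Real.exp (e / 2) * Real.exp (-((l + 1 / 2) * e)) := by
    rw [Real.inv_rpow hb0.le, ← Real.rpow_neg hb0.le, Real.rpow_def_of_pos hb0, hexp, hb,
      ← Real.exp_add, ← Real.exp_add]
    congr 1; ring
  -- This is `cosh ((l + 1 / 2) e) / cosh (e / 2)`; the denominator is dropped and `cosh z ≤ exp (z
  -- ^ 2 / 2)` finishes.
  have hp3 : 1 / (1 + b) * b ^ (1 + l) + b / (1 + b) * b⁻¹ ^ (1 + l) =
      2 * Real.exp (e / 2) / (1 + b) * Real.cosh ((l + 1 / 2) * e) := by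
    have : b / (1 + b) * b⁻¹ ^ (1 + l) = (b * b⁻¹ ^ (1 + l)) / (1 + b) := by ring
    rw [this, hp1, hp2, Real.cosh_eq]; ring
  rw [hp3]
  have hsq : b = Real.exp (e / 2) ^ 2 := by rw [← Real.exp_nat_mul, hb]; congr 1; push_cast; ring
  have h4 : 2 * Real.exp (e / 2) / (1 + b) ≤ 1 := by
    rw [div_le_one (by linarith), hsq]; nlinarith [sq_nonneg (Real.exp (e / 2) - 1)]
  calc _ ≤ 1 * Real.cosh ((l + 1 / 2) * e) :=
        mul_le_mul_of_nonneg_right h4 (Real.cosh_pos _).le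
    _ ≤ _ := by
        rw [one_mul]
        refine (Real.cosh_le_exp_half_sq _).trans_eq ?_
        congr 1; ring

/-- The moment bound for one phase is uniform in the earlier outcomes, so the bounds multiply even
though the phases are adaptive. -/
theorem sum_historyWeight_mul_exp_le [Fintype K] {p q : List K → K → ℝ} {e l : ℝ}
    (he : 0 ≤ e) (hl : 0 ≤ l) (hp : ∀ w a, 0 ≤ p w a) (hq : ∀ w a, 0 ≤ q w a)
    (hp1 : ∀ w, ∑ a, p w a = 1) (hq1 : ∀ w, ∑ a, q w a = 1)
    (h : ∀ w a, p w a ≤ Real.exp e * q w a) (h' : ∀ w a, q w a ≤ Real.exp e * p w a) (n : ℕ) :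
    ∑ w ∈ listsOfLength K n, historyWeight p w * Real.exp (l * historyLoss p q w) ≤
      Real.exp (n * ((l + 1 / 2) ^ 2 * e ^ 2 / 2)) := by
  induction n with
  | zero => simp [listsOfLength, historyWeight, historyLoss]
  | succ n ih =>
    rw [sum_listsOfLength_succ]
    have h1 : ∀ w ∈ listsOfLength K n,
        ∑ a, historyWeight p (a :: w) * Real.exp (l * historyLoss p q (a :: w)) ≤
        (historyWeight p w * Real.exp (l * historyLoss p q w)) *
          Real.exp ((l + 1 / 2) ^ 2 * e ^ 2 / 2) := by
      intro w _
      have h2 : ∀ a, historyWeight p (a :: w) * Real.exp (l * historyLoss p q (a :: w)) =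
          (historyWeight p w * Real.exp (l * historyLoss p q w)) *
            (p w a * Real.exp (l * Real.log (p w a / q w a))) := fun a => by
        rw [historyWeight, historyLoss, mul_add, Real.exp_add]; ring
      simp_rw [h2]
      rw [← Finset.mul_sum]
      exact mul_le_mul_of_nonneg_left
        (sum_mul_exp_log_div_le he hl (hp w) (hq w) (hp1 w) (hq1 w) (h w) (h' w))
        (mul_nonneg (historyWeight_nonneg hp w) (Real.exp_pos _).le)
    refine (Finset.sum_le_sum h1).trans ?_
    rw [← Finset.sum_mul, Nat.cast_add_one, add_mul, one_mul, Real.exp_add]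
    exact mul_le_mul_of_nonneg_right ih (Real.exp_pos _).le

variable [MeasurableSpace Ω] {P : Measure Ω} [IsProbabilityMeasure P]

/-- A prescribed history fixes which map every phase applies, so the event constrains each seed
separately. Histories are stored most recent first, so the head of `a :: w` uses the seed of index
`w.length`. -/
theorem exists_box_phaseHistory {k : List K → Ω → K} (hk : ∀ w a, MeasurableSet {ω | k w ω = a})
    (w : List K) : ∃ t : ℕ → Set Ω, (∀ i, MeasurableSet (t i)) ∧
      {ω : ℕ → Ω | phaseHistory k ω w.length = w} = Set.pi (Finset.range w.length) t ∧
      ∏ i ∈ Finset.range w.length, P.real (t i) =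
        historyWeight (fun w a => P.real {ω | k w ω = a}) w := by
  induction w with
  | nil => exact ⟨fun _ => Set.univ, by simp, by simp [phaseHistory], by simp [historyWeight]⟩
  | cons a w ih =>
    obtain ⟨t, ht, hbox, hprod⟩ := ih
    refine ⟨Function.update t w.length {ω | k w ω = a}, fun i => ?_, ?_, ?_⟩
    · by_cases hi : i = w.length
      · subst hi; simpa using hk w a
      · simpa [Function.update_of_ne hi] using ht i
    · ext ω
      have hb : phaseHistory k ω w.length = w ↔ ∀ i < w.length, ω i ∈ t i := by
        have := Set.ext_iff.mp hbox ω
        simpa using this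
      have hupd : ∀ i < w.length, Function.update t w.length {ω | k w ω = a} i = t i :=
        fun i hi => Function.update_of_ne hi.ne _ _
      simp only [Set.mem_ofPred_eq, List.length_cons, phaseHistory, List.cons.injEq, Set.mem_pi,
        Finset.coe_range, Set.mem_Iio, Nat.lt_succ_iff_lt_or_eq]
      constructor
      · rintro ⟨h1, h2⟩ i (hi | rfl)
        · rw [hupd i hi]; exact hb.mp h2 i hi
        · simpa [h2] using h1
      · intro h
        have h2 := hb.mpr fun i hi => by simpa [hupd i hi] using h i (Or.inl hi)
        exact ⟨by simpa [h2] using h _ (Or.inr rfl), h2⟩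
    · rw [List.length_cons, Finset.prod_range_succ, Function.update_self, historyWeight, ← hprod,
        mul_comm]
      congr 1
      exact Finset.prod_congr rfl fun i hi => by
        rw [Function.update_of_ne (Finset.mem_range.mp hi).ne]

theorem measurableSet_phaseHistory_eq {k : List K → Ω → K}
    (hk : ∀ w a, MeasurableSet {ω | k w ω = a}) (n : ℕ) (w : List K) :
    MeasurableSet {ω : ℕ → Ω | phaseHistory k ω n = w} := by
  by_cases hn : w.length = n
  · subst hn
    induction w with
    | nil => simp [phaseHistory]
    | cons a w ih =>
      have : {ω : ℕ → Ω | phaseHistory k ω (a :: w).length = a :: w} =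
          (fun ω => ω w.length) ⁻¹' {ω | k w ω = a} ∩ {ω | phaseHistory k ω w.length = w} := by
        ext ω
        simp only [Set.mem_ofPred_eq, List.length_cons, phaseHistory, List.cons.injEq,
          Set.mem_inter_iff, Set.mem_preimage]
        constructor
        · rintro ⟨h1, h2⟩; rw [h2] at h1; exact ⟨h1, h2⟩
        · rintro ⟨h1, h2⟩; rw [h2]; exact ⟨h1, rfl⟩
      rw [this]
      exact ((hk w a).preimage (measurable_pi_apply _)).inter ih
  · have : {ω : ℕ → Ω | phaseHistory k ω n = w} = ∅ := by
      ext ω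
      simp only [Set.mem_ofPred_eq, Set.mem_empty_iff_false, iff_false]
      rintro rfl
      exact hn (phaseHistory_length k ω n)
    rw [this]; exact MeasurableSet.empty

theorem measureReal_phaseHistory_eq {k : List K → Ω → K}
    (hk : ∀ w a, MeasurableSet {ω | k w ω = a}) (w : List K) :
    (Measure.infinitePi fun _ : ℕ => P).real {ω | phaseHistory k ω w.length = w} =
      historyWeight (fun w a => P.real {ω | k w ω = a}) w := by
  obtain ⟨t, ht, hbox, hprod⟩ := exists_box_phaseHistory (P := P) hk w
  rw [hbox, ← hprod, Measure.real, Measure.infinitePi_pi _ fun i _ => ht i, ENNReal.toReal_prod]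
  rfl

open scoped Classical in
theorem measureReal_phaseHistory_mem [Fintype K] {k : List K → Ω → K}
    (hk : ∀ w a, MeasurableSet {ω | k w ω = a}) (n : ℕ) (G : Set (List K)) :
    (Measure.infinitePi fun _ : ℕ => P).real {ω | phaseHistory k ω n ∈ G} =
      ∑ w ∈ listsOfLength K n with w ∈ G, historyWeight (fun w a => P.real {ω | k w ω = a}) w := by
  have h1 : {ω : ℕ → Ω | phaseHistory k ω n ∈ G} =
      ⋃ w ∈ (listsOfLength K n).filter (· ∈ G), {ω | phaseHistory k ω n = w} := by
    ext ω
    simp [mem_listsOfLength, phaseHistory_length]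
  rw [h1, measureReal_biUnion_finset]
  · refine Finset.sum_congr rfl fun w hw => ?_
    have hl := (mem_listsOfLength n w).mp (Finset.mem_filter.mp hw).1
    rw [← measureReal_phaseHistory_eq hk w, hl]
  · intro w _ w' _ hne
    refine Set.disjoint_left.mpr fun ω h1 h2 => hne ?_
    exact Eq.trans (Eq.symm h1) h2
  · exact fun w _ => measurableSet_phaseHistory_eq hk n w

theorem sum_measureReal_eq_one [Fintype K] {f : Ω → K} (hf : ∀ a, MeasurableSet {ω | f ω = a}) :
    ∑ a, P.real {ω | f ω = a} = 1 := by
  rw [← measureReal_biUnion_finset _ fun a _ => hf a]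
  · have : ⋃ a ∈ (Finset.univ : Finset K), {ω | f ω = a} = Set.univ := by ext; simp
    rw [this]; simp
  · intro a _ b _ hne
    refine Set.disjoint_left.mpr fun ω h1 h2 => hne ?_
    exact Eq.trans (Eq.symm h1) h2

/-- Basic composition. -/
theorem phaseHistory_pure_composition [Fintype K] {k k' : List K → Ω → K} {e : ℝ}
    (hk : ∀ w a, MeasurableSet {ω | k w ω = a}) (hk' : ∀ w a, MeasurableSet {ω | k' w ω = a})
    (h : ∀ w a, P.real {ω | k w ω = a} ≤ Real.exp e * P.real {ω | k' w ω = a})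
    (n : ℕ) (G : Set (List K)) :
    (Measure.infinitePi fun _ : ℕ => P).real {ω | phaseHistory k ω n ∈ G} ≤
      Real.exp (n * e) *
        (Measure.infinitePi fun _ : ℕ => P).real {ω | phaseHistory k' ω n ∈ G} := by
  classical
  rw [measureReal_phaseHistory_mem hk, measureReal_phaseHistory_mem hk', Finset.mul_sum]
  refine Finset.sum_le_sum fun w hw => ?_
  have hl := (mem_listsOfLength n w).mp (Finset.mem_filter.mp hw).1
  rw [← hl]
  exact historyWeight_le_pow (fun _ _ => measureReal_nonneg) (fun _ _ => measureReal_nonneg) h w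

/-- Advanced composition. -/
theorem phaseHistory_approx_composition [Fintype K] {k k' : List K → Ω → K} {e ε D : ℝ}
    (hk : ∀ w a, MeasurableSet {ω | k w ω = a}) (hk' : ∀ w a, MeasurableSet {ω | k' w ω = a})
    (he : 0 ≤ e) (h : ∀ w a, P.real {ω | k w ω = a} ≤ Real.exp e * P.real {ω | k' w ω = a})
    (h' : ∀ w a, P.real {ω | k' w ω = a} ≤ Real.exp e * P.real {ω | k w ω = a})
    (hε : 0 < ε) (hεD : ε ≤ 2 * D) {n : ℕ} (hn : 8 * n * D * e ^ 2 ≤ ε ^ 2) (G : Set (List K)) :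
    (Measure.infinitePi fun _ : ℕ => P).real {ω | phaseHistory k ω n ∈ G} ≤
      Real.exp ε * (Measure.infinitePi fun _ : ℕ => P).real {ω | phaseHistory k' ω n ∈ G} +
        Real.exp (-D) := by
  classical
  set p : List K → K → ℝ := fun w a => P.real {ω | k w ω = a} with hp
  set q : List K → K → ℝ := fun w a => P.real {ω | k' w ω = a} with hq
  have hp0 : ∀ w a, 0 ≤ p w a := fun _ _ => measureReal_nonneg
  have hq0 : ∀ w a, 0 ≤ q w a := fun _ _ => measureReal_nonneg
  set l : ℝ := 2 * D / ε with hl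
  have hl1 : 1 ≤ l := by rw [hl, le_div_iff₀ hε]; linarith
  have hlε : l * ε = 2 * D := by rw [hl]; field_simp
  rw [measureReal_phaseHistory_mem hk, measureReal_phaseHistory_mem hk', Finset.mul_sum]
  -- The same split at loss `ε` as for the Gaussian mechanism: `exp (-l ε) = exp (-2 D)` pays for a
  -- moment of at most `exp D`.
  have h1 : ∀ w, historyWeight p w ≤ Real.exp ε * historyWeight q w +
      Real.exp (-(l * ε)) * (historyWeight p w * Real.exp (l * historyLoss p q w)) := by
    intro w
    have hpw := historyWeight_nonneg hp0 w
    have hqw := historyWeight_nonneg hq0 w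
    rcases le_total (historyLoss p q w) ε with hle | hle
    · refine le_trans ?_ (le_add_of_nonneg_right (by positivity))
      rw [historyWeight_eq_exp_mul hp0 hq0 h h' w]
      exact mul_le_mul_of_nonneg_right (Real.exp_le_exp.mpr hle) hqw
    · refine le_trans ?_ (le_add_of_nonneg_left (by positivity))
      rw [mul_left_comm, ← Real.exp_add]
      refine le_mul_of_one_le_right hpw (Real.one_le_exp ?_)
      nlinarith
  refine (Finset.sum_le_sum fun w _ => h1 w).trans ?_
  rw [Finset.sum_add_distrib]
  refine add_le_add le_rfl ?_
  refine (Finset.sum_le_sum_of_subset_of_nonneg (Finset.filter_subset _ _) fun w _ _ => ?_).trans ?_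
  · have hpw := historyWeight_nonneg hp0 w
    positivity
  rw [← Finset.mul_sum]
  refine (mul_le_mul_of_nonneg_left (sum_historyWeight_mul_exp_le he (by linarith : 0 ≤ l) hp0 hq0
    (fun w => sum_measureReal_eq_one (hk w)) (fun w => sum_measureReal_eq_one (hk' w)) h h' n)
    (Real.exp_pos _).le).trans ?_
  rw [← Real.exp_add, hlε]
  refine Real.exp_le_exp.mpr ?_
  have hD : 0 < D := by linarith
  have h2 : n * ((l + 1 / 2) ^ 2 * e ^ 2 / 2) ≤ D := by
    -- With this bound the exponent is at most `2 n l ^ 2 e ^ 2 = 8 n D ^ 2 e ^ 2 / ε ^ 2`, whence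
    -- the constant `8` in `hn`.
    have h3 : (l + 1 / 2) ^ 2 ≤ 4 * l ^ 2 := by nlinarith
    have h4 : n * ((l + 1 / 2) ^ 2 * e ^ 2 / 2) ≤ n * (4 * l ^ 2 * e ^ 2 / 2) := by gcongr
    refine h4.trans ?_
    have h5 : (n * (4 * l ^ 2 * e ^ 2 / 2)) * ε ^ 2 ≤ D * ε ^ 2 := by
      have : (n * (4 * l ^ 2 * e ^ 2 / 2)) * ε ^ 2 = n * e ^ 2 * 2 * (l * ε) ^ 2 := by ring
      rw [this, hlε]
      nlinarith
    exact le_of_mul_le_mul_right h5 (by positivity)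
  linarith

end Composition

/-! ### The sparse vector technique -/

section SparseVector

/-- The noise of the query with index `i`. -/
noncomputable def queryNoise {N : ℕ} (ω : Option (Fin N) → ℝ) (i : ℕ) : ℝ :=
  if h : i < N then ω (some ⟨i, h⟩) else 0

/-- The noisy value of the query with index `i` exceeds the noisy threshold. -/
def ExceedsThreshold {N : ℕ} (τ : ℝ) (q : ℕ → ℝ) (ω : Option (Fin N) → ℝ) (i : ℕ) : Prop :=
  τ + ω none < q i + queryNoise ω i

/-- The first index, from `s` on, of a query that exceeds the threshold; `N` if there is none. -/
noncomputable def haltingIndex {N : ℕ} (τ : ℝ) (s : ℕ) (q : ℕ → ℝ) (ω : Option (Fin N) → ℝ) : ℕ :=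
  sInf {i | N ≤ i ∨ s ≤ i ∧ ExceedsThreshold τ q ω i}

variable {N : ℕ} {τ : ℝ} {s : ℕ} {q q' : ℕ → ℝ} {ω ω' : Option (Fin N) → ℝ}

theorem haltingIndex_le : haltingIndex τ s q ω ≤ N := Nat.sInf_le (Or.inl le_rfl)

theorem not_exceedsThreshold_of_lt_haltingIndex {i : ℕ} (hi : i < haltingIndex τ s q ω)
    (hs : s ≤ i) : ¬ ExceedsThreshold τ q ω i :=
  fun h => Nat.notMem_of_lt_sInf hi (Or.inr ⟨hs, h⟩)

theorem le_haltingIndex_or_eq (τ : ℝ) (s : ℕ) (q : ℕ → ℝ) (ω : Option (Fin N) → ℝ) :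
    haltingIndex τ s q ω = N ∨
      s ≤ haltingIndex τ s q ω ∧ ExceedsThreshold τ q ω (haltingIndex τ s q ω) := by
  have h : haltingIndex τ s q ω ∈ {i | N ≤ i ∨ s ≤ i ∧ ExceedsThreshold τ q ω i} :=
    Nat.sInf_mem ⟨N, Or.inl le_rfl⟩
  exact h.imp (fun h => le_antisymm haltingIndex_le h) id

theorem haltingIndex_eq_iff {i : ℕ} (hi : i ≤ N) : haltingIndex τ s q ω = i ↔
    (∀ r, s ≤ r → r < i → ¬ ExceedsThreshold τ q ω r) ∧
      (i < N → s ≤ i ∧ ExceedsThreshold τ q ω i) := by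
  constructor
  · rintro rfl
    refine ⟨fun r hr h => not_exceedsThreshold_of_lt_haltingIndex h hr, fun h => ?_⟩
    exact (le_haltingIndex_or_eq τ s q ω).resolve_left h.ne
  · rintro ⟨h1, h2⟩
    refine le_antisymm (Nat.sInf_le ?_) ?_
    · rcases hi.eq_or_lt with h | h
      · exact Or.inl h.ge
      · exact Or.inr (h2 h)
    · by_contra! hlt
      rcases le_haltingIndex_or_eq τ s q ω with h | h
      · omega
      · exact h1 _ h.1 hlt h.2

/-- Causality: a halt before `n` is decided by the queries before `n`. -/
theorem haltingIndex_congr {n : ℕ} (h : ∀ r < n, q r = q' r)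
    (hlt : haltingIndex τ s q ω < n) : haltingIndex τ s q' ω = haltingIndex τ s q ω := by
  have hE : ∀ r < n, (ExceedsThreshold τ q ω r ↔ ExceedsThreshold τ q' ω r) := fun r hr => by
    rw [ExceedsThreshold, ExceedsThreshold, h r hr]
  obtain ⟨h1, h2⟩ := (haltingIndex_eq_iff (haltingIndex_le (q := q))).mp rfl
  refine (haltingIndex_eq_iff haltingIndex_le).mpr ⟨fun r hs hr => ?_, fun hN => ?_⟩
  · rw [← hE r (hr.trans hlt)]; exact h1 r hs hr
  · rw [← hE _ hlt]; exact h2 hN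

theorem measurable_queryNoise (i : ℕ) :
    Measurable fun ω : Option (Fin N) → ℝ => queryNoise ω i := by
  unfold queryNoise
  split_ifs <;> fun_prop

theorem measurableSet_haltingIndex_eq (τ : ℝ) (s : ℕ) (q : ℕ → ℝ) (i : ℕ) :
    MeasurableSet {ω : Option (Fin N) → ℝ | haltingIndex τ s q ω = i} := by
  have hE : ∀ r, MeasurableSet {ω : Option (Fin N) → ℝ | ExceedsThreshold τ q ω r} := fun r =>
    measurableSet_lt (by fun_prop) ((measurable_queryNoise r).const_add _)
  by_cases hi : i ≤ N
  · simp_rw [haltingIndex_eq_iff hi]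
    refine MeasurableSet.inter (s₁ := {ω | ∀ r, s ≤ r → r < i → ¬ ExceedsThreshold τ q ω r})
      (s₂ := {ω | i < N → s ≤ i ∧ ExceedsThreshold τ q ω i}) ?_ ?_
    · have : {ω : Option (Fin N) → ℝ | ∀ r, s ≤ r → r < i → ¬ ExceedsThreshold τ q ω r} =
          ⋂ r, ⋂ (_ : s ≤ r), ⋂ (_ : r < i), {ω | ExceedsThreshold τ q ω r}ᶜ := by
        ext ω; simp
      rw [this]
      exact MeasurableSet.iInter fun r => MeasurableSet.iInter fun _ => MeasurableSet.iInter fun _ =>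
        (hE r).compl
    · have : {ω : Option (Fin N) → ℝ | i < N → s ≤ i ∧ ExceedsThreshold τ q ω i} =
          ⋂ (_ : i < N), {ω | s ≤ i} ∩ {ω | ExceedsThreshold τ q ω i} := by
        ext ω; simp
      rw [this]
      exact MeasurableSet.iInter fun _ =>
        (MeasurableSet.const _).inter (hE i)
  · have : {ω : Option (Fin N) → ℝ | haltingIndex τ s q ω = i} = ∅ := by
      ext ω
      simp only [Set.mem_ofPred_eq, Set.mem_empty_iff_false, iff_false]
      rintro rfl
      exact hi haltingIndex_le
    rw [this]; exact MeasurableSet.empty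

/-- Privacy of the search for the first query above the threshold. -/
theorem measureReal_haltingIndex_le {η : ℝ} (hη : 0 < η) (h : ∀ i < N, |q i - q' i| ≤ 1) (i : ℕ) :
    (Measure.pi fun _ : Option (Fin N) => laplaceMeasure η).real {ω | haltingIndex τ s q ω = i} ≤
      Real.exp (3 * η) * (Measure.pi fun _ : Option (Fin N) => laplaceMeasure η).real
        {ω | haltingIndex τ s q' ω = i} := by
  have := isProbabilityMeasure_laplaceMeasure hη
  by_cases hi : i ≤ N
  swap
  · have : {ω : Option (Fin N) → ℝ | haltingIndex τ s q ω = i} = ∅ := by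
      ext ω
      simp only [Set.mem_ofPred_eq, Set.mem_empty_iff_false, iff_false]
      rintro rfl
      exact hi haltingIndex_le
    rw [this, measureReal_empty]
    positivity
  -- Raising the threshold by `1` keeps the earlier queries below it although each may grow by `1`.
  -- Query `i` may lose `1` and faces the higher threshold, so its noise gains `2`. The total shift
  -- is at most `3`, whatever `N` is.
  set v : Option (Fin N) → ℝ := fun o => o.elim 1 fun j => if (j : ℕ) = i then 2 else 0 with hv
  have hsum : ∑ o, |v o| ≤ 3 := by
    rw [Fintype.sum_option]
    simp only [hv, Option.elim]
    have h2 : ∑ j : Fin N, |if (j : ℕ) = i then (2 : ℝ) else 0| ≤ 2 := by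
      by_cases hiN : i < N
      · rw [Finset.sum_eq_single ⟨i, hiN⟩]
        · simp
        · intro j _ hj
          have : (j : ℕ) ≠ i := fun h => hj (Fin.ext h)
          simp [this]
        · simp
      · rw [Finset.sum_eq_zero]
        · norm_num
        · intro j _
          have : (j : ℕ) ≠ i := by have := j.2; omega
          simp [this]
    rw [abs_one]; linarith
  have hsub : {ω : Option (Fin N) → ℝ | haltingIndex τ s q ω = i} ⊆
      {ω | ω + v ∈ {ω | haltingIndex τ s q' ω = i}} := by
    intro ω hω
    simp only [Set.mem_ofPred_eq, haltingIndex_eq_iff hi] at hω ⊢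
    have hnoise : ∀ r < N, queryNoise (ω + v) r = queryNoise ω r + if r = i then 2 else 0 := by
      intro r hr
      simp [queryNoise, hr, hv]
    have hnone : (ω + v) none = ω none + 1 := by simp [hv]
    refine ⟨fun r hs hr hE => hω.1 r hs hr ?_, fun hiN => ⟨(hω.2 hiN).1, ?_⟩⟩
    · have hrN := hr.trans_le hi
      have := abs_le.mp (h r hrN)
      rw [ExceedsThreshold, hnoise r hrN, hnone, if_neg hr.ne] at hE
      rw [ExceedsThreshold]; linarith
    · have h1 := (hω.2 hiN).2
      have := abs_le.mp (h i hiN)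
      rw [ExceedsThreshold] at h1
      rw [ExceedsThreshold, hnoise i hiN, hnone, if_pos rfl]; linarith
  have key := (measure_mono hsub).trans (laplace_pi_translate_le hη v
    (measurableSet_haltingIndex_eq (N := N) τ s q' i))
  refine (ENNReal.toReal_mono (by finiteness) key).trans ?_
  rw [ENNReal.toReal_mul, ENNReal.toReal_ofReal (Real.exp_pos _).le]
  refine mul_le_mul_of_nonneg_right (Real.exp_le_exp.mpr ?_) ENNReal.toReal_nonneg
  nlinarith

end SparseVector

/-! ### The tracking algorithm: privacy of a phase, causality, accuracy -/

section Tracking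

/-- Even queries ask for an increase of the estimate, odd queries for a decrease. -/
def querySign (i : ℕ) : ℝ := if Even i then 1 else -1

theorem querySign_two_mul (t : ℕ) : querySign (2 * t) = 1 := by simp [querySign]

theorem querySign_two_mul_add_one (t : ℕ) : querySign (2 * t + 1) = -1 := by simp [querySign]

theorem querySign_eq (i : ℕ) : querySign i = 1 ∨ querySign i = -1 := by
  unfold querySign; split_ifs <;> simp

variable {T : ℕ}

/-- The time of the most recent halting query, counted from `0`. -/
def currentTime : List (Fin (2 * T + 1)) → ℕ
  | [] => 0
  | a :: _ => a / 2

/-- The net number of increases of the estimate caused by queries with index less than `n`. -/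
def levelBefore (n : ℕ) : List (Fin (2 * T + 1)) → ℝ
  | [] => 0
  | a :: w => levelBefore n w + if (a : ℕ) < n then querySign a else 0

/-- The value of the query with index `i`, when the values to track are `u`. -/
def trackingQuery (τ : ℝ) (u : ℕ → ℝ) (w : List (Fin (2 * T + 1))) (i : ℕ) : ℝ :=
  querySign i * (u (i / 2 + 1) - (u 0 + τ * levelBefore (2 * T) w))

/-- One phase of the tracking algorithm: find the first query that exceeds the threshold. -/
noncomputable def trackingPhase (τ : ℝ) (u : ℕ → ℝ) (w : List (Fin (2 * T + 1)))
    (ω : Option (Fin (2 * T)) → ℝ) : Fin (2 * T + 1) :=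
  -- The search resumes at both queries of the time of the last halt, so the estimate may move
  -- several times within one time step.
  ⟨haltingIndex τ (2 * currentTime w) (trackingQuery τ u w) ω, Nat.lt_succ_of_le haltingIndex_le⟩

theorem measurableSet_trackingPhase_eq (τ : ℝ) (u : ℕ → ℝ) (w : List (Fin (2 * T + 1)))
    (a : Fin (2 * T + 1)) : MeasurableSet {ω | trackingPhase τ u w ω = a} := by
  simp_rw [trackingPhase, Fin.ext_iff]
  exact measurableSet_haltingIndex_eq _ _ _ _

/-- Given the earlier outcomes, the estimate is the same for both inputs, because it starts from the
common value `u 0`. The queries thus differ only through the tracked values. -/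
theorem measureReal_trackingPhase_le {η τ : ℝ} (hη : 0 < η) {u u' : ℕ → ℝ} (h0 : u 0 = u' 0)
    (h : ∀ t < T, |u (t + 1) - u' (t + 1)| ≤ 1) (w : List (Fin (2 * T + 1)))
    (a : Fin (2 * T + 1)) :
    (Measure.pi fun _ : Option (Fin (2 * T)) => laplaceMeasure η).real
        {ω | trackingPhase τ u w ω = a} ≤
      Real.exp (3 * η) * (Measure.pi fun _ : Option (Fin (2 * T)) => laplaceMeasure η).real
        {ω | trackingPhase τ u' w ω = a} := by
  simp_rw [trackingPhase, Fin.ext_iff]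
  refine measureReal_haltingIndex_le hη (fun i hi => ?_) _
  have : trackingQuery τ u w i - trackingQuery τ u' w i =
      querySign i * (u (i / 2 + 1) - u' (i / 2 + 1)) := by
    rw [trackingQuery, trackingQuery, h0]; ring
  rw [this, abs_mul]
  have h1 : |querySign i| = 1 := by rcases querySign_eq i with h | h <;> simp [h]
  rw [h1, one_mul]
  exact h _ (by omega)

theorem le_trackingPhase (τ : ℝ) (u : ℕ → ℝ) {w : List (Fin (2 * T + 1))} {t : ℕ} (ht : t ≤ T)
    (hw : t ≤ currentTime w) (ω : Option (Fin (2 * T)) → ℝ) :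
    2 * t ≤ (trackingPhase τ u w ω : ℕ) := by
  simp only [trackingPhase]
  rcases le_haltingIndex_or_eq τ (2 * currentTime w) (trackingQuery τ u w) ω with h | h
  · omega
  · have := h.1; omega

/-- The outcomes up to time `t` depend only on the values up to time `t`. -/
theorem levelBefore_phaseHistory_congr {τ : ℝ} {u u' : ℕ → ℝ} {t : ℕ} (ht : t ≤ T)
    (h : ∀ r ≤ t, u r = u' r) (ω : ℕ → Option (Fin (2 * T)) → ℝ) (n : ℕ) :
    levelBefore (2 * t) (phaseHistory (trackingPhase τ u) ω n) =
      levelBefore (2 * t) (phaseHistory (trackingPhase τ u') ω n) := by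
  -- The two runs agree until a halt at an index of at least `2 * t`; from then on both stay at or
  -- past time `t` and neither changes its level before `2 * t`.
  suffices H : phaseHistory (trackingPhase τ u) ω n = phaseHistory (trackingPhase τ u') ω n ∨
      (t ≤ currentTime (phaseHistory (trackingPhase τ u) ω n) ∧
        t ≤ currentTime (phaseHistory (trackingPhase τ u') ω n) ∧
        levelBefore (2 * t) (phaseHistory (trackingPhase τ u) ω n) =
          levelBefore (2 * t) (phaseHistory (trackingPhase τ u') ω n)) by
    rcases H with H | H
    · rw [H]
    · exact H.2.2
  induction n with
  | zero => exact Or.inl rfl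
  | succ n ih =>
    simp only [phaseHistory]
    set w := phaseHistory (trackingPhase τ u) ω n
    set w' := phaseHistory (trackingPhase τ u') ω n
    have late : ∀ a b : Fin (2 * T + 1), 2 * t ≤ (a : ℕ) → 2 * t ≤ (b : ℕ) →
        levelBefore (2 * t) w = levelBefore (2 * t) w' →
        t ≤ currentTime (a :: w) ∧ t ≤ currentTime (b :: w') ∧
          levelBefore (2 * t) (a :: w) = levelBefore (2 * t) (b :: w') := by
      intro a b ha hb hl
      refine ⟨by simp only [currentTime]; omega, by simp only [currentTime]; omega, ?_⟩
      rw [levelBefore, levelBefore, if_neg (by omega), if_neg (by omega), hl]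
    rcases ih with ih | ⟨h1, h2, h3⟩
    · have hq : ∀ r < 2 * t, trackingQuery τ u w r = trackingQuery τ u' w r := by
        intro r hr
        rw [trackingQuery, trackingQuery, h 0 (by omega), h _ (by omega)]
      by_cases hlt : (trackingPhase τ u w (ω n) : ℕ) < 2 * t
      · left
        rw [← ih]
        congr 1
        exact Fin.ext (haltingIndex_congr hq hlt).symm
      · right
        refine late _ _ (by omega) ?_ (by rw [ih])
        by_contra! hlt'
        rw [← ih] at hlt'
        exact hlt ((haltingIndex_congr (fun r hr => (hq r hr).symm) hlt').trans_lt hlt')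
    · exact Or.inr (late _ _ (le_trackingPhase τ u ht h1 _) (le_trackingPhase τ u' ht h2 _) h3)

theorem abs_queryNoise_le {N : ℕ} {ω : Option (Fin N) → ℝ} {B : ℝ} (hB : 0 ≤ B)
    (hω : ∀ o, |ω o| ≤ B) (i : ℕ) : |queryNoise ω i| ≤ B := by
  unfold queryNoise
  split_ifs
  · exact hω _
  · simpa using hB

/-- Each halting query decreases the error of the estimate. -/
theorem error_add_mul_le_variation {τ B : ℝ} {u : ℕ → ℝ} (hB : 0 ≤ B)
    {ω : ℕ → Option (Fin (2 * T)) → ℝ} {n : ℕ} (hω : ∀ j < n, ∀ o, |ω j o| ≤ B)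
    (hlt : currentTime (phaseHistory (trackingPhase τ u) ω n) < T) :
    |u (currentTime (phaseHistory (trackingPhase τ u) ω n) + 1) -
        (u 0 + τ * levelBefore (2 * T) (phaseHistory (trackingPhase τ u) ω n))| +
        n * (τ - 4 * B) ≤
      ∑ r ∈ Finset.range (currentTime (phaseHistory (trackingPhase τ u) ω n) + 1),
        |u (r + 1) - u r| := by
  induction n with
  | zero => simp [phaseHistory, currentTime, levelBefore]
  | succ n ih =>
    simp only [phaseHistory] at hlt ⊢
    set w := phaseHistory (trackingPhase τ u) ω n
    set i := trackingPhase τ u w (ω n) with hi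
    have hw : currentTime w < T := by
      by_contra! hc
      have := le_trackingPhase τ u le_rfl hc (ω n)
      simp only [currentTime] at hlt
      omega
    have ih := ih (fun j hj => hω j (by omega)) hw
    simp only [currentTime] at hlt ⊢
    have hiN : (i : ℕ) < 2 * T := by omega
    have hex := (le_haltingIndex_or_eq τ (2 * currentTime w) (trackingQuery τ u w) (ω n)).resolve_left
      (by simp only [hi, trackingPhase] at hiN; omega)
    have hi' : haltingIndex τ (2 * currentTime w) (trackingQuery τ u w) (ω n) = i := rfl
    rw [hi'] at hex
    have hle : currentTime w + 1 ≤ (i : ℕ) / 2 + 1 := by omega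
    have hvar : |u ((i : ℕ) / 2 + 1) - u (currentTime w + 1)| ≤
        ∑ r ∈ Finset.Ico (currentTime w + 1) ((i : ℕ) / 2 + 1), |u (r + 1) - u r| := by
      rw [← Finset.sum_Ico_sub u hle]
      exact Finset.abs_sum_le_sum_abs _ _
    rw [← Finset.sum_range_add_sum_Ico _ hle]
    have hex2 := hex.2
    rw [ExceedsThreshold, trackingQuery] at hex2
    have hn1 := abs_le.mp (hω n (by omega) none)
    have hn2 := abs_le.mp (abs_queryNoise_le hB (hω n (by omega)) i)
    rw [levelBefore, if_pos hiN]
    set a := u 0 + τ * levelBefore (2 * T) w with ha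
    have ha' : u 0 + τ * (levelBefore (2 * T) w + querySign i) = a + τ * querySign i := by
      rw [ha]; ring
    simp only [ha', Nat.cast_add_one]
    have htri : |u ((i : ℕ) / 2 + 1) - a| ≤
        |u ((i : ℕ) / 2 + 1) - u (currentTime w + 1)| + |u (currentTime w + 1) - a| :=
      abs_sub_le _ _ _
    -- The halt shows that the error in the direction of the move exceeds `τ - 2 * B`. Either the
    -- move removes the full `τ`, or it overshoots and leaves an error below `2 * B`; both gain at
    -- least `τ - 4 * B`.
    have hdec : |u ((i : ℕ) / 2 + 1) - (a + τ * querySign i)| ≤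
        |u ((i : ℕ) / 2 + 1) - a| - (τ - 4 * B) := by
      set y := u ((i : ℕ) / 2 + 1)
      rcases querySign_eq i with h | h <;> rw [h] at hex2 ⊢ <;> rw [abs_le] <;>
        rcases abs_cases (y - a) with hc | hc <;> constructor <;> linarith
    linarith

/-- Once the algorithm has passed time `t`, its estimate for that time is accurate. -/
theorem error_le_of_lt_currentTime {τ B : ℝ} {u : ℕ → ℝ} (hB : 0 ≤ B)
    {ω : ℕ → Option (Fin (2 * T)) → ℝ} {n t : ℕ} (ht : t < T) (hω : ∀ j < n, ∀ o, |ω j o| ≤ B)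
    (hlt : t < currentTime (phaseHistory (trackingPhase τ u) ω n)) :
    |u (t + 1) - (u 0 + τ * levelBefore (2 * (t + 1)) (phaseHistory (trackingPhase τ u) ω n))| ≤
      τ + 2 * B := by
  suffices H : (currentTime (phaseHistory (trackingPhase τ u) ω n) ≤ t ∧
      levelBefore (2 * (t + 1)) (phaseHistory (trackingPhase τ u) ω n) =
        levelBefore (2 * T) (phaseHistory (trackingPhase τ u) ω n)) ∨
      (t < currentTime (phaseHistory (trackingPhase τ u) ω n) ∧
      |u (t + 1) - (u 0 + τ * levelBefore (2 * (t + 1)) (phaseHistory (trackingPhase τ u) ω n))| ≤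
        τ + 2 * B) by
    rcases H with H | H
    · omega
    · exact H.2
  clear hlt
  induction n with
  | zero => left; simp [phaseHistory, currentTime, levelBefore]
  | succ n ih =>
    have ih := ih (fun j hj => hω j (by omega))
    simp only [phaseHistory]
    set w := phaseHistory (trackingPhase τ u) ω n
    set i := trackingPhase τ u w (ω n) with hi
    simp only [currentTime, levelBefore]
    rcases ih with ⟨h1, h2⟩ | ⟨h1, h2⟩
    · by_cases hit : (i : ℕ) < 2 * (t + 1)
      · left
        rw [if_pos hit, if_pos (by omega), h2]
        exact ⟨by omega, rfl⟩
      · right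
        rw [if_neg hit, add_zero, h2]
        refine ⟨by omega, ?_⟩
        -- The search that leaves time `t` found neither of its two queries above the threshold,
        -- which bounds the error from both sides.
        have hno : ∀ r, 2 * t ≤ r → r < 2 * (t + 1) →
            ¬ ExceedsThreshold τ (trackingQuery τ u w) (ω n) r := fun r hr hr' =>
          not_exceedsThreshold_of_lt_haltingIndex (s := 2 * currentTime w)
            (show r < (i : ℕ) by omega) (by omega)
        have e1 := hno (2 * t) le_rfl (by omega)
        have e2 := hno (2 * t + 1) (by omega) (by omega)
        rw [ExceedsThreshold, trackingQuery, not_lt] at e1 e2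
        rw [querySign_two_mul, show 2 * t / 2 = t by omega] at e1
        rw [querySign_two_mul_add_one, show (2 * t + 1) / 2 = t by omega] at e2
        have hn1 := abs_le.mp (hω n (by omega) none)
        have hn2 := abs_le.mp (abs_queryNoise_le hB (hω n (by omega)) (2 * t))
        have hn3 := abs_le.mp (abs_queryNoise_le hB (hω n (by omega)) (2 * t + 1))
        rw [abs_le]
        constructor <;> linarith
    · right
      have hge : 2 * (t + 1) ≤ (i : ℕ) := le_trackingPhase τ u (by omega) h1 (ω n)
      rw [if_neg (by omega), add_zero]
      exact ⟨by omega, h2⟩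

end Tracking

/-! ### The algorithms, their privacy and their error -/

section Algorithms

variable {d T : ℕ} {Q : List (ItemUpdate d) → ℝ} {x y : UpdateStream d T}

theorem one_sub_le_measureReal {Ω : Type*} [MeasurableSpace Ω] {μ : Measure Ω}
    [IsProbabilityMeasure μ] {E F : Set Ω} {β : ℝ} (hβ : 0 ≤ β) (h : ∀ ω, ω ∉ F → ω ∈ E)
    (hF : μ F ≤ ENNReal.ofReal β) : 1 - β ≤ μ.real E := by
  have h1 : (1 : ℝ) ≤ μ.real E + μ.real F := by
    rw [← probReal_univ (μ := μ)]
    exact (measureReal_mono fun ω _ => or_iff_not_imp_right.mpr (h ω)).trans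
      (measureReal_union_le E F)
  have h2 : μ.real F ≤ β := ENNReal.toReal_le_of_le_ofReal hβ hF
  linarith

theorem ItemNeighboring.symm (h : ItemNeighboring x y) : ItemNeighboring y x := by
  obtain ⟨i, hi⟩ := h
  exact ⟨i, fun t j hj => (hi t j hj).symm⟩

theorem ContinualAlgorithm.IsItemDP.mono {A : ContinualAlgorithm d} {ε ε' δ δ' : ℝ}
    (h : A.IsItemDP T ε δ) (hε : ε ≤ ε') (hδ : δ ≤ δ') : A.IsItemDP T ε' δ' := by
  intro x y hxy S hS
  refine (h x y hxy S hS).trans (add_le_add (mul_le_mul_of_nonneg_right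
    (Real.exp_le_exp.mpr hε) ?_) hδ)
  exact ENNReal.toReal_nonneg

theorem ContinualAlgorithm.HasErrorAtMost.mono {A : ContinualAlgorithm d} {α α' β : ℝ}
    (h : A.HasErrorAtMost Q x α β) (hα : α ≤ α') : A.HasErrorAtMost Q x α' β := by
  have := A.events
  have := A.isProbability
  exact le_trans h (measureReal_mono fun ω hω t => (hω t).trans hα)

theorem valueAt_zero (Q : List (ItemUpdate d) → ℝ) (x : UpdateStream d T) :
    valueAt Q x 0 = Q [] := by
  simp [valueAt, upToTime]

theorem length_upToTime (x : UpdateStream d T) {t : ℕ} (ht : t ≤ T) : (upToTime x t).length = t := by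
  simp [upToTime, ht]

theorem timeVariation_eq_sum_range (Q : List (ItemUpdate d) → ℝ) (x : UpdateStream d T) :
    timeVariation Q x = ∑ r ∈ Finset.range T, |valueAt Q x (r + 1) - valueAt Q x r| := by
  have h := Finset.sum_Ico_add' (fun t => |valueAt Q x t - valueAt Q x (t - 1)|) 0 T 1
  simp only [zero_add, Nat.add_sub_cancel] at h
  rw [timeVariation, Finset.range_eq_Ico, h]
  rfl

theorem abs_valueAt_sub_le_timeVariation (Q : List (ItemUpdate d) → ℝ) (x : UpdateStream d T)
    {t : ℕ} (ht : t ≤ T) : |valueAt Q x t - Q []| ≤ timeVariation Q x := by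
  rw [timeVariation_eq_sum_range, ← valueAt_zero Q x, ← Finset.sum_range_sub (valueAt Q x) t]
  refine (Finset.abs_sum_le_sum_abs _ _).trans ?_
  exact Finset.sum_le_sum_of_subset_of_nonneg (Finset.range_mono ht) fun _ _ _ => abs_nonneg _

/-- The algorithm that ignores the stream. -/
noncomputable def constantAlgorithm (d : ℕ) (c : ℝ) : ContinualAlgorithm d where
  Seed := Unit
  events := inferInstance
  law := Measure.dirac ()
  isProbability := inferInstance
  output _ _ := c
  measurable_output _ := measurable_const

theorem constantAlgorithm_isItemDP (c : ℝ) {ε δ : ℝ} (hε : 0 ≤ ε) (hδ : 0 ≤ δ) :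
    (constantAlgorithm d c).IsItemDP T ε δ := by
  intro x y _ S _
  have h : 0 ≤ (constantAlgorithm d c).pr
      {ω | (constantAlgorithm d c).transcript y ω ∈ S} := ENNReal.toReal_nonneg
  have h1 := Real.one_le_exp hε
  change (constantAlgorithm d c).pr {ω | (constantAlgorithm d c).transcript y ω ∈ S} ≤ _
  nlinarith

theorem constantAlgorithm_hasErrorAtMost {K β : ℝ} (hβ : 0 ≤ β) (hx : timeVariation Q x ≤ K) :
    (constantAlgorithm d (Q [])).HasErrorAtMost Q x K β := by
  refine one_sub_le_measureReal (μ := Measure.dirac ()) (F := ∅) hβ (fun ω _ t => ?_) (by simp)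
  rw [abs_sub_comm]
  exact (abs_valueAt_sub_le_timeVariation Q x (by omega)).trans hx

/-- The algorithm that adds independent noise with law `μ` to each of the first `T` values. -/
noncomputable def additiveNoiseAlgorithm (T : ℕ) (Q : List (ItemUpdate d) → ℝ) (μ : Measure ℝ)
    (hμ : IsProbabilityMeasure μ) : ContinualAlgorithm d where
  Seed := Fin T → ℝ
  events := inferInstance
  law := Measure.pi fun _ => μ
  isProbability := inferInstance
  -- The output at time `t` uses coordinate `t - 1`. The empty sequence and those longer than `T` do
  -- not occur in a transcript, so their outputs are immaterial.
  output u ω := Q u + if h : u.length - 1 < T then ω ⟨u.length - 1, h⟩ else 0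
  measurable_output u := by split_ifs <;> fun_prop

theorem additiveNoiseAlgorithm_transcript {μ : Measure ℝ} (hμ : IsProbabilityMeasure μ)
    (ω : Fin T → ℝ) :
    (additiveNoiseAlgorithm T Q μ hμ).transcript x ω =
      fun t : Fin T => valueAt Q x (t + 1) + ω t := by
  funext t
  have h : (upToTime x ((t : ℕ) + 1)).length - 1 = t := by
    rw [length_upToTime x t.2, Nat.succ_sub_one]
  simp only [ContinualAlgorithm.transcript, additiveNoiseAlgorithm, h, t.2, dif_pos, valueAt]

/-- Passing to a neighboring stream translates the noise by the vector of differences of the values,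
whose entries are at most `1` in absolute value. -/
theorem additiveNoiseAlgorithm_isItemDP {μ : Measure ℝ} (hμ : IsProbabilityMeasure μ) {ε δ : ℝ}
    (hδ : 0 ≤ δ) (hQ : HasUnitItemSensitivity T Q)
    (h : ∀ (v : Fin T → ℝ) (A : Set (Fin T → ℝ)), (∀ t, |v t| ≤ 1) → MeasurableSet A →
      (Measure.pi fun _ : Fin T => μ) {ω | ω + v ∈ A} ≤
        ENNReal.ofReal (Real.exp ε) * (Measure.pi fun _ : Fin T => μ) A + ENNReal.ofReal δ) :
    (additiveNoiseAlgorithm T Q μ hμ).IsItemDP T ε δ := by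
  intro x y hxy S hS
  have hA : MeasurableSet {ω : Fin T → ℝ | (fun t : Fin T => valueAt Q y (t + 1) + ω t) ∈ S} :=
    hS.preimage (f := fun (ω : Fin T → ℝ) (t : Fin T) => valueAt Q y (t + 1) + ω t) (by fun_prop)
  have key := h (fun t => valueAt Q x (t + 1) - valueAt Q y (t + 1)) _
    (fun t => hQ x y hxy _ (by have := t.2; simp)) hA
  have h0 : ∀ z : UpdateStream d T,
      {ω | (additiveNoiseAlgorithm T Q μ hμ).transcript z ω ∈ S} =
        {ω : Fin T → ℝ | (fun t : Fin T => valueAt Q z (t + 1) + ω t) ∈ S} := fun z =>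
    Set.ext fun ω => iff_of_eq (congrArg (· ∈ S) (additiveNoiseAlgorithm_transcript hμ ω))
  rw [h0, h0]
  have h1 : {ω : Fin T → ℝ | (fun t : Fin T => valueAt Q x (t + 1) + ω t) ∈ S} =
      {ω | ω + (fun t : Fin T => valueAt Q x (t + 1) - valueAt Q y (t + 1)) ∈
        {ω : Fin T → ℝ | (fun t : Fin T => valueAt Q y (t + 1) + ω t) ∈ S}} := by
    ext ω
    simp only [Set.mem_ofPred_eq, Pi.add_apply]
    have : (fun t : Fin T => valueAt Q x (t + 1) + ω t) = fun t : Fin T => valueAt Q y (t + 1) +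
        (ω t + (valueAt Q x (t + 1) - valueAt Q y (t + 1))) := by funext t; ring
    rw [this]
  change (Measure.pi fun _ : Fin T => μ).real _ ≤ _ * (Measure.pi fun _ : Fin T => μ).real _ + _
  rw [h1]
  refine (ENNReal.toReal_mono (by finiteness) key).trans_eq ?_
  rw [ENNReal.toReal_add (by finiteness) (by finiteness), ENNReal.toReal_mul,
    ENNReal.toReal_ofReal (Real.exp_pos _).le, ENNReal.toReal_ofReal hδ]
  rfl

theorem additiveNoiseAlgorithm_hasErrorAtMost {μ : Measure ℝ} (hμ : IsProbabilityMeasure μ)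
    {α β : ℝ} (hβ : 0 ≤ β) (h : T * μ {z | α < |z|} ≤ ENNReal.ofReal β) :
    (additiveNoiseAlgorithm T Q μ hμ).HasErrorAtMost Q x α β := by
  refine one_sub_le_measureReal (μ := Measure.pi fun _ : Fin T => μ)
    (F := ⋃ t, {ω | α < |ω t|}) hβ (fun ω hω t => ?_) ?_
  · rw [additiveNoiseAlgorithm_transcript]
    simp only [Set.mem_iUnion, Set.mem_ofPred_eq, not_exists, not_lt] at hω
    simpa using hω t
  · refine (measure_iUnion_le _).trans (le_trans ?_ h)
    have h1 : ∀ t : Fin T, (Measure.pi fun _ : Fin T => μ) {ω | α < |ω t|} = μ {z | α < |z|} :=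
      fun t => (measurePreserving_eval (fun _ : Fin T => μ) t).measure_preimage
        (s := {z | α < |z|}) (measurableSet_lt measurable_const (by fun_prop)).nullMeasurableSet
    simp [h1]

theorem exists_laplace_algorithm {ε β : ℝ} (hT : 1 ≤ T) (hε : 0 < ε) (hβ : 0 < β) (hβ1 : β < 1)
    (hQ : HasUnitItemSensitivity T Q) :
    ∃ A : ContinualAlgorithm d, A.IsItemDP T ε 0 ∧
      ∀ x : UpdateStream d T, A.HasErrorAtMost Q x (ε⁻¹ * T * Real.log (T / β)) β := by
  have hT0 : (0 : ℝ) < T := by exact_mod_cast hT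
  have hT1 : (1 : ℝ) ≤ T := by exact_mod_cast hT
  have hη : 0 < ε / T := by positivity
  have hL : 0 ≤ Real.log (T / β) := Real.log_nonneg (by rw [le_div_iff₀ hβ]; linarith)
  refine ⟨additiveNoiseAlgorithm T Q _ (isProbabilityMeasure_laplaceMeasure hη),
    additiveNoiseAlgorithm_isItemDP _ le_rfl hQ fun v A hv hA => ?_, fun x =>
    additiveNoiseAlgorithm_hasErrorAtMost _ hβ.le ?_⟩
  · refine (laplace_pi_translate_le hη v hA).trans (le_trans ?_ le_self_add)
    gcongr
    have : ∑ t, |v t| ≤ T := (Finset.sum_le_sum fun t _ => hv t).trans (by simp)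
    calc ε / T * ∑ t, |v t| ≤ ε / T * T := by gcongr
      _ = ε := by field_simp
  · rw [laplaceMeasure_abs_gt hη (by positivity), ← ENNReal.ofReal_natCast,
      ← ENNReal.ofReal_mul hT0.le]
    refine ENNReal.ofReal_le_ofReal ?_
    have : -(ε / T) * (ε⁻¹ * T * Real.log (T / β)) = -Real.log (T / β) := by field_simp
    rw [this, Real.exp_neg, Real.exp_log (by positivity)]
    field_simp
    exact le_rfl

theorem gaussianReal_abs_gt_le (v : ℝ≥0) {u : ℝ} (hu : 0 ≤ u) :
    gaussianReal 0 v {z | u < |z|} ≤ ENNReal.ofReal (2 * Real.exp (-u ^ 2 / (2 * v))) := by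
  have h1 : HasSubgaussianMGF (fun z : ℝ => z) v (gaussianReal 0 v) :=
    ⟨fun t => integrable_exp_mul_gaussianReal t, fun t => by
      rw [mgf_fun_id_gaussianReal]; simp⟩
  have h2 : HasSubgaussianMGF (fun z : ℝ => -z) v (gaussianReal 0 v) := h1.neg
  have h3 := h1.measure_ge_le hu
  have h4 := h2.measure_ge_le hu
  have h5 : (gaussianReal 0 v).real {z | u < |z|} ≤ 2 * Real.exp (-u ^ 2 / (2 * v)) := by
    have hsub : {z : ℝ | u < |z|} ⊆ {z | u ≤ z} ∪ {z | u ≤ -z} := by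
      intro z hz
      rcases lt_abs.mp (show u < |z| from hz) with h | h
      · exact Or.inl h.le
      · exact Or.inr h.le
    refine (measureReal_mono hsub).trans ((measureReal_union_le _ _).trans ?_)
    linarith
  rw [← ofReal_measureReal]
  exact ENNReal.ofReal_le_ofReal h5

theorem exists_gaussian_algorithm {ε β D : ℝ} (hT : 1 ≤ T) (hε : 0 < ε) (hεD : ε ≤ 2 * D)
    (hβ : 0 < β) (hβ1 : β < 1) (hL : 1 / 2 ≤ Real.log (T / β))
    (hQ : HasUnitItemSensitivity T Q) :
    ∃ A : ContinualAlgorithm d, A.IsItemDP T ε (Real.exp (-D)) ∧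
      ∀ x : UpdateStream d T,
        A.HasErrorAtMost Q x (5 * (ε⁻¹ * Real.sqrt (T * D * Real.log (T / β)))) β := by
  have hD : 0 < D := by linarith
  have hT0 : (0 : ℝ) < T := by exact_mod_cast hT
  have hT1 : (1 : ℝ) ≤ T := by exact_mod_cast hT
  set L := Real.log (T / β) with hLdef
  have hexpL : Real.exp (-L) = β / T := by
    rw [hLdef, Real.exp_neg, Real.exp_log (by positivity), inv_div]
  -- The least variance that the Gaussian mechanism allows for `T` coordinates.
  set σ : ℝ≥0 := Real.toNNReal (4 * D * T / ε ^ 2) with hσdef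
  have hσ : (σ : ℝ) = 4 * D * T / ε ^ 2 := Real.coe_toNNReal _ (by positivity)
  have hσ0 : 0 < σ := by rw [← NNReal.coe_pos, hσ]; positivity
  refine ⟨additiveNoiseAlgorithm T Q (gaussianReal 0 σ) inferInstance,
    additiveNoiseAlgorithm_isItemDP _ (Real.exp_pos _).le hQ fun v A hv hA =>
      gaussian_pi_translate_le hε hεD hσ0 ?_ hv hA, fun x =>
    additiveNoiseAlgorithm_hasErrorAtMost _ hβ.le ?_⟩
  · rw [hσ, Fintype.card_fin]
    field_simp
    exact le_rfl
  · refine (mul_le_mul_right (gaussianReal_abs_gt_le σ (by positivity)) _).trans ?_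
    rw [← ENNReal.ofReal_natCast, ← ENNReal.ofReal_mul hT0.le]
    refine ENNReal.ofReal_le_ofReal ?_
    have h1 : -(5 * (ε⁻¹ * Real.sqrt (T * D * L))) ^ 2 / (2 * σ) = -(25 / 8 * L) := by
      rw [hσ, mul_pow, mul_pow, Real.sq_sqrt (by positivity)]
      field_simp
      norm_num
    rw [h1]
    -- Since `L ≥ 1 / 2`, the spare `17 / 8 * L` exceeds `1`; the resulting factor `exp (-1) ≤ 1 /
    -- 2` absorbs the `2` of the two-sided tail.
    have h2 : Real.exp (-(25 / 8 * L)) ≤ Real.exp (-L) * Real.exp (-1) := by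
      rw [← Real.exp_add]; exact Real.exp_le_exp.mpr (by linarith)
    have h3 : Real.exp (-1) ≤ 1 / 2 := by
      have := Real.exp_one_gt_d9
      rw [Real.exp_neg, inv_le_comm₀ (Real.exp_pos _) (by norm_num)]
      linarith
    calc T * (2 * Real.exp (-(25 / 8 * L))) ≤ T * (2 * (β / T * (1 / 2))) := by
          rw [← hexpL]
          gcongr
          exact h2.trans (mul_le_mul_of_nonneg_left h3 (Real.exp_pos _).le)
      _ = β := by field_simp

theorem measurableSet_phaseHistory_mem {K Ω : Type*} [Fintype K] [MeasurableSpace Ω]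
    {k : List K → Ω → K} (hk : ∀ w a, MeasurableSet {ω | k w ω = a}) (n : ℕ) (G : Set (List K)) :
    MeasurableSet {ω : ℕ → Ω | phaseHistory k ω n ∈ G} := by
  have h1 : {ω : ℕ → Ω | phaseHistory k ω n ∈ G} =
      ⋃ w ∈ {w | w ∈ listsOfLength K n ∧ w ∈ G}, {ω | phaseHistory k ω n = w} := by
    ext ω
    simp [mem_listsOfLength, phaseHistory_length]
  rw [h1]
  refine MeasurableSet.biUnion ?_ fun w _ => measurableSet_phaseHistory_eq hk n w
  exact ((listsOfLength K n).finite_toSet.subset fun w hw => hw.1).countable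

/-- The algorithm that changes its estimate by `τ` whenever a noisy comparison of the error of the
estimate with `τ` asks for it, at most `n` times. -/
noncomputable def trackingAlgorithm (T n : ℕ) (Q : List (ItemUpdate d) → ℝ) (τ : ℝ) {η : ℝ}
    (hη : 0 < η) : ContinualAlgorithm d where
  Seed := ℕ → Option (Fin (2 * T)) → ℝ
  events := inferInstance
  law :=
    haveI := isProbabilityMeasure_laplaceMeasure hη
    Measure.infinitePi fun _ => Measure.pi fun _ => laplaceMeasure η
  isProbability :=
    haveI := isProbabilityMeasure_laplaceMeasure hη
    inferInstance
  output u ω := Q [] + τ * levelBefore (2 * u.length)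
    -- Beyond the length of `u`, `u.take r` is `u`, so the unknown future is filled with the current
    -- value; the level before `2 * u.length` does not see it.
    (phaseHistory (trackingPhase (T := T) τ fun r => Q (u.take r)) ω n)
  measurable_output u := fun B _ =>
    measurableSet_phaseHistory_mem (measurableSet_trackingPhase_eq τ fun r => Q (u.take r)) n
      {w | Q [] + τ * levelBefore (2 * u.length) w ∈ B}

/-- By causality all outputs are read off one run on the whole stream, so privacy of its history
passes to the transcript by post-processing. -/
theorem trackingAlgorithm_transcript {n : ℕ} {τ η : ℝ} (hη : 0 < η)
    (ω : ℕ → Option (Fin (2 * T)) → ℝ) :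
    (trackingAlgorithm T n Q τ hη).transcript x ω = fun t : Fin T => Q [] + τ *
      levelBefore (2 * (t + 1)) (phaseHistory (trackingPhase τ (valueAt Q x)) ω n) := by
  funext t
  simp only [ContinualAlgorithm.transcript, trackingAlgorithm, length_upToTime x t.2]
  rw [levelBefore_phaseHistory_congr (u' := valueAt Q x) t.2]
  intro r hr
  rw [valueAt, upToTime, upToTime, List.take_take, min_eq_left hr]

theorem trackingAlgorithm_setOf_transcript_mem (x : UpdateStream d T) {n : ℕ} {τ η : ℝ}
    (hη : 0 < η) (S : Set (Fin T → ℝ)) :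
    {ω | (trackingAlgorithm T n Q τ hη).transcript x ω ∈ S} =
      {ω : ℕ → Option (Fin (2 * T)) → ℝ | phaseHistory (trackingPhase τ (valueAt Q x)) ω n ∈
        {w | (fun t : Fin T => Q [] + τ * levelBefore (2 * (t + 1)) w) ∈ S}} :=
  Set.ext fun ω => iff_of_eq (congrArg (· ∈ S) (trackingAlgorithm_transcript hη ω))

theorem trackingPhase_ratio {τ η : ℝ} (hη : 0 < η) (hQ : HasUnitItemSensitivity T Q)
    (hxy : ItemNeighboring x y) (w : List (Fin (2 * T + 1))) (a : Fin (2 * T + 1)) :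
    (Measure.pi fun _ : Option (Fin (2 * T)) => laplaceMeasure η).real
        {ω | trackingPhase τ (valueAt Q x) w ω = a} ≤
      Real.exp (3 * η) * (Measure.pi fun _ : Option (Fin (2 * T)) => laplaceMeasure η).real
        {ω | trackingPhase τ (valueAt Q y) w ω = a} :=
  measureReal_trackingPhase_le hη (by rw [valueAt_zero, valueAt_zero])
    (fun t ht => hQ x y hxy _ (by simp; omega)) w a

theorem trackingAlgorithm_isItemDP_pure {n : ℕ} {τ η : ℝ} (hη : 0 < η)
    (hQ : HasUnitItemSensitivity T Q) :
    (trackingAlgorithm T n Q τ hη).IsItemDP T (n * (3 * η)) 0 := by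
  have := isProbabilityMeasure_laplaceMeasure hη
  intro x y hxy S _
  rw [trackingAlgorithm_setOf_transcript_mem, trackingAlgorithm_setOf_transcript_mem, add_zero]
  exact phaseHistory_pure_composition
    (P := Measure.pi fun _ : Option (Fin (2 * T)) => laplaceMeasure η)
    (measurableSet_trackingPhase_eq τ (valueAt Q x)) (measurableSet_trackingPhase_eq τ (valueAt Q y))
    (trackingPhase_ratio hη hQ hxy) n
    {w | (fun t : Fin T => Q [] + τ * levelBefore (2 * (t + 1)) w) ∈ S}

/-- Advanced composition with `e = 3 * η`, whence `72 = 8 * 3 ^ 2`. -/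
theorem trackingAlgorithm_isItemDP_approx {n : ℕ} {τ η ε D : ℝ} (hη : 0 < η)
    (hQ : HasUnitItemSensitivity T Q) (hε : 0 < ε) (hεD : ε ≤ 2 * D)
    (hn : 72 * n * D * η ^ 2 ≤ ε ^ 2) :
    (trackingAlgorithm T n Q τ hη).IsItemDP T ε (Real.exp (-D)) := by
  have := isProbabilityMeasure_laplaceMeasure hη
  intro x y hxy S _
  rw [trackingAlgorithm_setOf_transcript_mem, trackingAlgorithm_setOf_transcript_mem]
  exact phaseHistory_approx_composition
    (P := Measure.pi fun _ : Option (Fin (2 * T)) => laplaceMeasure η)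
    (measurableSet_trackingPhase_eq τ (valueAt Q x)) (measurableSet_trackingPhase_eq τ (valueAt Q y))
    (by positivity) (trackingPhase_ratio hη hQ hxy) (trackingPhase_ratio hη hQ hxy.symm)
    hε hεD (by linarith)
    {w | (fun t : Fin T => Q [] + τ * levelBefore (2 * (t + 1)) w) ∈ S}

/-- If all noises are at most `B`, then `n` halts before the end would need variation at least `n *
(4 * B) > K`, so the run passes every time and the error is at most `τ + 2 * B`. The failure
probability is a union bound over `n` phases with `2 * T + 1` noises each. -/
theorem trackingAlgorithm_hasErrorAtMost {n : ℕ} {B η K β : ℝ} (hη : 0 < η) (hB : 0 ≤ B)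
    (hβ : 0 ≤ β) (hK : K < n * (4 * B)) (hn : n * (2 * T + 1) * Real.exp (-η * B) ≤ β)
    (hx : timeVariation Q x ≤ K) :
    (trackingAlgorithm T n Q (8 * B) hη).HasErrorAtMost Q x (10 * B) β := by
  have := isProbabilityMeasure_laplaceMeasure hη
  set μ : Measure (ℕ → Option (Fin (2 * T)) → ℝ) :=
    Measure.infinitePi fun _ => Measure.pi fun _ => laplaceMeasure η with hμ
  refine one_sub_le_measureReal (μ := μ)
    (F := ⋃ j ∈ Finset.range n, ⋃ o, {ω | B < |ω j o|}) hβ (fun ω hω t => ?_) ?_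
  · simp only [Set.mem_iUnion, Set.mem_ofPred_eq, not_exists, not_lt, Finset.mem_range] at hω
    rw [trackingAlgorithm_transcript, abs_sub_comm]
    have hend : (t : ℕ) < currentTime (phaseHistory (trackingPhase (8 * B) (valueAt Q x)) ω n) := by
      refine t.2.trans_le ?_
      by_contra! hlt
      have h1 := error_add_mul_le_variation hB hω hlt
      have h2 := Finset.sum_le_sum_of_subset_of_nonneg (Finset.range_mono hlt)
        (f := fun r => |valueAt Q x (r + 1) - valueAt Q x r|) fun _ _ _ => abs_nonneg _
      rw [← timeVariation_eq_sum_range] at h2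
      have h3 := abs_nonneg (valueAt Q x
        (currentTime (phaseHistory (trackingPhase (8 * B) (valueAt Q x)) ω n) + 1) -
          (valueAt Q x 0 + 8 * B * levelBefore (2 * T)
            (phaseHistory (trackingPhase (8 * B) (valueAt Q x)) ω n)))
      have h4 : (n : ℝ) * (8 * B - 4 * B) = n * (4 * B) := by ring
      simp only [Nat.succ_eq_add_one] at h2
      linarith
    have := error_le_of_lt_currentTime hB t.2 hω hend
    rw [valueAt_zero] at this
    exact this.trans (by linarith)
  · have h1 : ∀ j o, μ {ω | B < |ω j o|} = ENNReal.ofReal (Real.exp (-η * B)) := by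
      intro j o
      have hms : MeasurableSet {z : ℝ | B < |z|} := measurableSet_lt measurable_const (by fun_prop)
      rw [← laplaceMeasure_abs_gt hη hB,
        ← (measurePreserving_eval (fun _ : Option (Fin (2 * T)) => laplaceMeasure η) o).measure_preimage
          hms.nullMeasurableSet,
        ← (measurePreserving_eval_infinitePi (fun _ : ℕ =>
          Measure.pi fun _ : Option (Fin (2 * T)) => laplaceMeasure η) j).measure_preimage
          (hms.preimage (measurable_pi_apply o)).nullMeasurableSet]
      rfl
    refine (measure_biUnion_finset_le _ _).trans
      ((Finset.sum_le_sum fun j _ => measure_iUnion_le _).trans ?_)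
    simp only [h1, tsum_fintype, Finset.sum_const, Finset.card_univ, Fintype.card_option,
      Fintype.card_fin, Finset.card_range, nsmul_eq_mul]
    rw [← ENNReal.ofReal_natCast, ← ENNReal.ofReal_natCast, ← ENNReal.ofReal_mul (by positivity),
      ← ENNReal.ofReal_mul (by positivity)]
    refine ENNReal.ofReal_le_ofReal (le_trans (le_of_eq ?_) hn)
    push_cast
    ring

theorem exists_tracking_algorithm {n : ℕ} {η K β : ℝ} (hT : 1 ≤ T) (hη : 0 < η) (hβ : 0 < β)
    (hβ1 : β < 1) (hL : 1 / 2 ≤ Real.log (T / β)) (hn : n ≤ 2 * T)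
    (hK : K < n * (28 * Real.log (T / β) / η)) (hQ : HasUnitItemSensitivity T Q) :
    ∃ A : ContinualAlgorithm d, A.IsItemDP T (n * (3 * η)) 0 ∧
      (∀ ε D : ℝ, 0 < ε → ε ≤ 2 * D → 72 * n * D * η ^ 2 ≤ ε ^ 2 →
        A.IsItemDP T ε (Real.exp (-D))) ∧
      ∀ x : UpdateStream d T, timeVariation Q x ≤ K →
        A.HasErrorAtMost Q x (70 * Real.log (T / β) / η) β := by
  have hT0 : (0 : ℝ) < T := by exact_mod_cast hT
  have hT1 : (1 : ℝ) ≤ T := by exact_mod_cast hT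
  have hn' : (n : ℝ) ≤ 2 * T := by exact_mod_cast hn
  set L := Real.log (T / β) with hLdef
  have hexpL : Real.exp (-L) = β / T := by
    rw [hLdef, Real.exp_neg, Real.exp_log (by positivity), inv_div]
  have hB : 0 ≤ 7 * L / η := by positivity
  refine ⟨trackingAlgorithm T n Q (8 * (7 * L / η)) hη, trackingAlgorithm_isItemDP_pure hη hQ,
    fun ε D hε hεD h => trackingAlgorithm_isItemDP_approx hη hQ hε hεD h, fun x hx => ?_⟩
  have h := trackingAlgorithm_hasErrorAtMost (Q := Q) (x := x) (n := n) (β := β) hη hB hβ.le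
    (hK.trans_eq (by ring)) ?_ hx
  · exact h.mono (le_of_eq (by ring))
  -- For `B = 7 * L / η` the tail is `exp (-7 * L)`: three factors `exp (-L) = β / T` beat the
  -- number of noises, at most `6 * T ^ 2`, and the other four cancel the `6`.
  have h1 : -η * (7 * L / η) = -L + -L + -L + -(4 * L) := by field_simp; ring
  have h2 : Real.exp (-(4 * L)) ≤ 1 / 6 := by
    have h3 : Real.exp (-(4 * L)) ≤ Real.exp (-2) := Real.exp_le_exp.mpr (by linarith)
    have h4 : Real.exp (-2) ≤ 1 / 6 := by
      have := Real.exp_one_gt_d9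
      have h5 : Real.exp 2 = Real.exp 1 * Real.exp 1 := by rw [← Real.exp_add]; norm_num
      rw [Real.exp_neg, inv_le_comm₀ (Real.exp_pos _) (by norm_num), h5]
      nlinarith
    exact h3.trans h4
  rw [h1, Real.exp_add, Real.exp_add, Real.exp_add, hexpL]
  calc n * (2 * T + 1) * (β / T * (β / T) * (β / T) * Real.exp (-(4 * L)))
      ≤ (2 * T) * (3 * T) * (β / T * (β / T) * (β / T) * (1 / 6)) := by
        gcongr
        linarith
    _ = β ^ 3 / T := by field_simp; ring
    _ ≤ β := by
        rw [div_le_iff₀ hT0]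
        have h6 : β ^ 2 ≤ 1 := by nlinarith
        have h7 : β ^ 3 = β * β ^ 2 := by ring
        rw [h7]
        exact mul_le_mul_of_nonneg_left (h6.trans hT1) hβ.le

end Algorithms

/-! ### Choice of the algorithm and of its parameters -/

section Selection

variable {d T : ℕ} {Q : List (ItemUpdate d) → ℝ}

/-- Only for `T = 1` can the logarithm be close to `0`, which would spoil the absorption of
constants into it. -/
theorem half_le_log_div {β : ℝ} (hT : 1 < T) (hβ : 0 < β) (hβ1 : β < 1) :
    1 / 2 ≤ Real.log (T / β) := by
  have h2 : (2 : ℝ) ≤ T := by exact_mod_cast hT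
  have h3 : (2 : ℝ) ≤ T / β := by rw [le_div_iff₀ hβ]; linarith
  have := Real.log_two_gt_d9
  linarith [Real.log_le_log (by norm_num) h3]

theorem exists_pure_algorithm {K ε β : ℝ} (hT : 1 ≤ T) (hK : 0 ≤ K) (hε : 0 < ε) (hβ : 0 < β)
    (hβ1 : β < 1) (hQ : HasUnitItemSensitivity T Q) :
    ∃ A : ContinualAlgorithm d, A.IsItemDP T ε 0 ∧
      ∀ x : UpdateStream d T, timeVariation Q x ≤ K →
        A.HasErrorAtMost Q x
          (420 * min K (min (Real.sqrt (ε⁻¹ * K * Real.log (T / β)))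
            (ε⁻¹ * T * Real.log (T / β)))) β := by
  have hT0 : (0 : ℝ) < T := by exact_mod_cast hT
  have hT1 : (1 : ℝ) ≤ T := by exact_mod_cast hT
  have hL : 0 < Real.log (T / β) := Real.log_pos (by rw [lt_div_iff₀ hβ]; linarith)
  have hhalf : 1 < T → 1 / 2 ≤ Real.log (T / β) := fun h => half_le_log_div h hβ hβ1
  set L := Real.log (T / β)
  set M := Real.sqrt (ε⁻¹ * K * L) with hM
  have hM0 : 0 ≤ M := Real.sqrt_nonneg _
  have hM2 : M ^ 2 = ε⁻¹ * K * L := Real.sq_sqrt (by positivity)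
  by_cases h1 : K ≤ min M (ε⁻¹ * T * L)
  · refine ⟨constantAlgorithm d (Q []), constantAlgorithm_isItemDP _ hε.le le_rfl, fun x hx =>
      (constantAlgorithm_hasErrorAtMost hβ.le hx).mono ?_⟩
    rw [min_eq_left h1]; linarith
  by_cases h2 : ε⁻¹ * T * L ≤ M
  · obtain ⟨A, hA, hA'⟩ := exists_laplace_algorithm hT hε hβ hβ1 hQ
    refine ⟨A, hA, fun x _ => (hA' x).mono ?_⟩
    rw [min_eq_right h2] at h1 ⊢
    rw [min_eq_right (not_le.mp h1).le]
    have : 0 ≤ ε⁻¹ * T * L := by positivity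
    linarith
  rw [not_le] at h2
  rw [min_eq_left h2.le] at h1 ⊢
  rw [not_le] at h1
  rw [min_eq_right h1.le]
  have hK0 : 0 < K := hM0.trans_lt h1
  have hMpos : 0 < M := Real.sqrt_pos.mpr (by positivity)
  -- `M < K` gives `R > 1`, and `M` below the Laplace term gives `R < T`. Hence `T > 1`, and
  -- rounding `R` up costs at most a factor `2`.
  have hLM : L < M * ε := by
    have h3 : ε⁻¹ * K * L < K * M := by rw [← hM2]; nlinarith
    have h4 : K * L < K * (M * ε) := by
      calc K * L = (ε⁻¹ * K * L) * ε := by field_simp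
        _ < (K * M) * ε := by gcongr
        _ = _ := by ring
    exact lt_of_mul_lt_mul_left h4 hK0.le
  have hMT : M * ε < T * L := by
    calc M * ε < (ε⁻¹ * T * L) * ε := by gcongr
      _ = T * L := by field_simp
  have hT2 : 1 < T := by
    have : (1 : ℝ) < T := by
      refine lt_of_mul_lt_mul_right (a := L) ?_ hL.le
      linarith
    exact_mod_cast this
  have hhalf := hhalf hT2
  -- The balanced number of phases: `K = R ^ 2 * L / ε`, while with `η = ε / (3 * n)` the tracker
  -- handles variation of order `n ^ 2 * L / ε`.
  set R := M * ε / L with hR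
  have hR1 : 1 < R := by rw [hR, lt_div_iff₀ hL]; linarith
  set n := ⌈R⌉₊ with hn
  have hRn : R ≤ n := Nat.le_ceil R
  have hn2 : (n : ℝ) ≤ 2 * R := by linarith [Nat.ceil_lt_add_one (show 0 ≤ R by linarith)]
  have hnT : n ≤ 2 * T := by
    have : n ≤ T := Nat.ceil_le.mpr (by rw [hR, div_le_iff₀ hL]; exact hMT.le)
    omega
  have hn0 : (0 : ℝ) < n := by linarith
  obtain ⟨A, hA, -, hA'⟩ := exists_tracking_algorithm (Q := Q) (n := n) (η := ε / (3 * n)) (K := K)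
    hT (by positivity) hβ hβ1 hhalf hnT (by
      have h5 : n * (28 * L / (ε / (3 * n))) = 84 * (n ^ 2 * L / ε) := by field_simp; ring
      have h6 : R ^ 2 * L / ε = K := by
        rw [hR, div_pow, mul_pow, hM2]; field_simp
      have h7 : R ^ 2 * L / ε ≤ n ^ 2 * L / ε := by gcongr
      change K < n * (28 * L / (ε / (3 * n)))
      rw [h5]
      linarith) hQ
  refine ⟨A, hA.mono (le_of_eq (by field_simp)) le_rfl, fun x hx => (hA' x hx).mono ?_⟩
  calc 70 * L / (ε / (3 * n)) = 210 * L * n / ε := by field_simp; ring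
    _ ≤ 210 * L * (2 * R) / ε := by gcongr
    _ = 420 * M := by rw [hR]; field_simp; ring

theorem cube_rpow_one_third {a : ℝ} (ha : 0 ≤ a) : (a ^ ((1 : ℝ) / 3)) ^ 3 = a := by
  rw [← Real.rpow_natCast, ← Real.rpow_mul ha]; norm_num

theorem rpow_one_third_le {a b c : ℝ} (ha : 0 ≤ a) (hb : 0 ≤ b) (hc : 0 ≤ c)
    (h : a ≤ c ^ 3 * b) : a ^ ((1 : ℝ) / 3) ≤ c * b ^ ((1 : ℝ) / 3) := by
  refine le_of_pow_le_pow_left₀ three_ne_zero (by positivity) ?_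
  rw [mul_pow, cube_rpow_one_third ha, cube_rpow_one_third hb]
  exact h

/-- The approximate case when `D = ln (1 / δ)` is at least `1` and `ε` is at most `2`. -/
theorem exists_approx_algorithm {K ε β D : ℝ} (hT : 1 ≤ T) (hK : 0 ≤ K) (hε : 0 < ε)
    (hε2 : ε ≤ 2) (hD : 1 ≤ D) (hβ : 0 < β) (hβ1 : β < 1) (hQ : HasUnitItemSensitivity T Q) :
    ∃ A : ContinualAlgorithm d, A.IsItemDP T ε (Real.exp (-D)) ∧
      ∀ x : UpdateStream d T, timeVariation Q x ≤ K →
        A.HasErrorAtMost Q x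
          (840 * min K (min ((ε⁻¹ ^ 2 * K * D * Real.log (T / β) ^ 2) ^ ((1 : ℝ) / 3))
            (ε⁻¹ * Real.sqrt (T * D * Real.log (T / β))))) β := by
  have hT0 : (0 : ℝ) < T := by exact_mod_cast hT
  have hT1 : (1 : ℝ) ≤ T := by exact_mod_cast hT
  have hD0 : 0 < D := by linarith
  have hL : 0 < Real.log (T / β) := Real.log_pos (by rw [lt_div_iff₀ hβ]; linarith)
  have hhalf : 1 < T → 1 / 2 ≤ Real.log (T / β) := fun h => half_le_log_div h hβ hβ1
  have hlap := exists_laplace_algorithm (Q := Q) hT hε hβ hβ1 hQ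
  have hgau := exists_gaussian_algorithm (D := D) hT hε (by linarith) hβ hβ1
    (Q := Q)
  have htrack := fun (n : ℕ) (η : ℝ) =>
    exists_tracking_algorithm (Q := Q) (n := n) (η := η) (K := K) (β := β) hT
  set L := Real.log (T / β)
  set M := (ε⁻¹ ^ 2 * K * D * L ^ 2) ^ ((1 : ℝ) / 3) with hM
  set G := ε⁻¹ * Real.sqrt (T * D * L) with hG
  have hG0 : 0 ≤ G := by positivity
  have hM0 : 0 ≤ M := by positivity
  have hM3 : M ^ 3 = ε⁻¹ ^ 2 * K * D * L ^ 2 := cube_rpow_one_third (by positivity)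
  have hG2 : G ^ 2 = ε⁻¹ ^ 2 * (T * D * L) := by
    rw [hG, mul_pow, Real.sq_sqrt (by positivity)]
  by_cases h1 : K ≤ min M G
  · refine ⟨constantAlgorithm d (Q []), constantAlgorithm_isItemDP _ hε.le (Real.exp_pos _).le,
      fun x hx => (constantAlgorithm_hasErrorAtMost hβ.le hx).mono ?_⟩
    rw [min_eq_left h1]; linarith
  rw [not_le] at h1
  have hK0 : 0 < K := (le_min hM0 hG0).trans_lt h1
  rw [min_eq_right h1.le]
  -- Here `T = 1`, and a single Laplace noise has error `ε⁻¹ * L`, which is below both `G` and `M`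
  -- because `K` is not the minimum.
  by_cases hLh : L < 1 / 2
  · have hT1' : T = 1 := by
      by_contra hne
      exact absurd (hhalf (by omega)) (by linarith)
    have hLG : ε⁻¹ * L ≤ G := by
      refine le_of_pow_le_pow_left₀ two_ne_zero hG0 ?_
      rw [hG2, mul_pow]
      gcongr
      nlinarith [mul_le_mul hT1 hD zero_le_one hT0.le]
    have hLM : ε⁻¹ * L ≤ M := by
      rcases le_total K (ε⁻¹ * L) with hc | hc
      · exfalso
        have : K ≤ M := by
          refine le_of_pow_le_pow_left₀ three_ne_zero hM0 ?_
          rw [hM3]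
          calc K ^ 3 = K ^ 2 * K * 1 := by ring
            _ ≤ (ε⁻¹ * L) ^ 2 * K * D := by gcongr
            _ = _ := by ring
        exact absurd h1 (not_lt.mpr (le_min this (hc.trans hLG)))
      · refine le_of_pow_le_pow_left₀ three_ne_zero hM0 ?_
        rw [hM3]
        calc (ε⁻¹ * L) ^ 3 = (ε⁻¹ * L) ^ 2 * (ε⁻¹ * L) * 1 := by ring
          _ ≤ (ε⁻¹ * L) ^ 2 * K * D := by gcongr
          _ = _ := by ring
    obtain ⟨A, hA, hA'⟩ := hlap
    refine ⟨A, hA.mono le_rfl (Real.exp_pos _).le, fun x _ => (hA' x).mono ?_⟩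
    have h3 : ε⁻¹ * T * L = ε⁻¹ * L := by rw [hT1']; simp
    rw [h3]
    have := le_min hLM hLG
    have h4 : 0 ≤ ε⁻¹ * L := by positivity
    linarith
  rw [not_lt] at hLh
  by_cases h2 : G ≤ M
  · obtain ⟨A, hA, hA'⟩ := hgau hLh hQ
    refine ⟨A, hA, fun x _ => (hA' x).mono ?_⟩
    rw [min_eq_right h2]
    linarith
  rw [not_le] at h2
  rw [min_eq_left h2.le] at h1 ⊢
  have hMpos : 0 < M := by positivity
  -- `R = W ^ 2 / D` satisfies `K = R * M` and is the balanced number of phases. Then `s = √(72 n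
  -- D)` is between `W` and `12 * W`, and `η = ε / s` exhausts the privacy budget exactly.
  set W := M * ε / L with hW
  have hWpos : 0 < W := by positivity
  set R := W ^ 2 / D with hR
  have hMW : M = W * L / ε := by rw [hW]; field_simp
  have hKR : K = R * M := by
    have h3 : M ^ 3 * ε ^ 2 = K * D * L ^ 2 := by rw [hM3]; field_simp
    rw [hR, hW]
    field_simp
    linarith
  have hR1 : 1 < R := by
    refine lt_of_mul_lt_mul_right (a := M) ?_ hM0
    linarith
  -- `M < G` gives `R ≤ T / L`, and `L ≥ 1 / 2`.
  have hRT : R ≤ 2 * T := by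
    have h3 : M ^ 2 ≤ G ^ 2 := by gcongr
    rw [hG2] at h3
    have h4 : M ^ 2 * ε ^ 2 ≤ T * D * L := by
      calc M ^ 2 * ε ^ 2 ≤ (ε⁻¹ ^ 2 * (T * D * L)) * ε ^ 2 := by gcongr
        _ = T * D * L := by field_simp
    rw [hR, hW, div_pow, mul_pow, div_div, div_le_iff₀ (by positivity)]
    refine h4.trans ?_
    have h5 : T * D * L * 1 ≤ T * D * L * (2 * L) := by gcongr; linarith
    linarith
  set n := ⌈R⌉₊ with hn
  have hRn : R ≤ n := Nat.le_ceil R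
  have hn2 : (n : ℝ) ≤ 2 * R := by linarith [Nat.ceil_lt_add_one (show 0 ≤ R by linarith)]
  have hnT : n ≤ 2 * T := Nat.ceil_le.mpr (by push_cast; exact hRT)
  have hn0 : (0 : ℝ) < n := by linarith
  set s := Real.sqrt (72 * n * D) with hs
  have hs0 : 0 < s := by positivity
  have hs2 : s ^ 2 = 72 * n * D := Real.sq_sqrt (by positivity)
  have hsW : s ≤ 12 * W := by
    refine le_of_pow_le_pow_left₀ two_ne_zero (by positivity) ?_
    have h3 : W ^ 2 = R * D := by rw [hR]; field_simp
    rw [hs2, mul_pow, h3]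
    nlinarith
  have hWs : W ≤ s := by
    refine le_of_pow_le_pow_left₀ two_ne_zero hs0.le ?_
    have h3 : W ^ 2 = R * D := by rw [hR]; field_simp
    rw [hs2, h3]
    nlinarith
  obtain ⟨A, -, hA, hA'⟩ := htrack n (ε / s) (by positivity) hβ hβ1 hLh hnT (by
    have h3 : n * (28 * L / (ε / s)) = 28 * (n * (s * L / ε)) := by field_simp
    rw [h3]
    have h4 : M ≤ s * L / ε := by rw [hMW]; gcongr
    have h5 : K ≤ n * (s * L / ε) := by
      rw [hKR]; exact mul_le_mul hRn h4 hM0 hn0.le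
    linarith) hQ
  refine ⟨A, hA ε D hε (by linarith) ?_, fun x hx => (hA' x hx).mono ?_⟩
  · rw [← hs2, div_pow]
    exact le_of_eq (by field_simp)
  · calc 70 * L / (ε / s) = 70 * L * s / ε := by field_simp
      _ ≤ 70 * L * (12 * W) / ε := by gcongr
      _ = 840 * M := by rw [hMW]; ring

end Selection

/-! ### Reduction of the approximate case to small `ε` and small `δ` -/

theorem theorem1p4 :
    (∃ C : ℝ, 0 < C ∧
      ∀ (d T : ℕ) (K ε β : ℝ) (Q : List (ItemUpdate d) → ℝ),
        1 ≤ T → 0 ≤ K → 0 < ε → 0 < β → β < 1 → HasUnitItemSensitivity T Q →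
        ∃ A : ContinualAlgorithm d, A.IsItemDP T ε 0 ∧
          ∀ x : UpdateStream d T, timeVariation Q x ≤ K →
            A.HasErrorAtMost Q x
              (C * min K (min (Real.sqrt (ε⁻¹ * K * Real.log (T / β)))
                (ε⁻¹ * T * Real.log (T / β)))) β) ∧
    (∀ ε₀ δ₀ : ℝ, 0 < ε₀ → 0 < δ₀ → δ₀ < 1 →
      ∃ C : ℝ, 0 < C ∧
        ∀ (d T : ℕ) (K ε δ β : ℝ) (Q : List (ItemUpdate d) → ℝ),
          1 ≤ T → 0 ≤ K → 0 < ε → ε ≤ ε₀ → 0 < δ → δ ≤ δ₀ → 0 < β → β < 1 →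
          HasUnitItemSensitivity T Q →
          ∃ A : ContinualAlgorithm d, A.IsItemDP T ε δ ∧
            ∀ x : UpdateStream d T, timeVariation Q x ≤ K →
              A.HasErrorAtMost Q x
                (C * min K (min
                  ((ε⁻¹ ^ 2 * K * Real.log (1 / δ) * Real.log (T / β) ^ 2) ^ ((1 : ℝ) / 3))
                  (ε⁻¹ * Real.sqrt (T * Real.log (1 / δ) * Real.log (T / β))))) β) := by
  refine ⟨⟨420, by norm_num, fun d T K ε β Q hT hK hε hβ hβ1 hQ =>
    exists_pure_algorithm hT hK hε hβ hβ1 hQ⟩, fun ε₀ δ₀ hε₀ hδ₀ hδ₀1 => ?_⟩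
  have hD₀ : 0 < Real.log (1 / δ₀) := Real.log_pos (by rwa [one_lt_div hδ₀])
  -- Running with `ε / κ₁ ≤ 2` and `max 1 D` in place of `D` only strengthens privacy. As `max 1 D ≤
  -- κ₂ * D`, each term of the error grows by at most the factor `κ₁ * κ₂`.
  set κ₁ := max 1 (ε₀ / 2)
  set κ₂ := max 1 (1 / Real.log (1 / δ₀))
  have hκ₁ : 1 ≤ κ₁ := le_max_left _ _
  have hκ₂ : 1 ≤ κ₂ := le_max_left _ _
  have hκ₁' : ε₀ / 2 ≤ κ₁ := le_max_right _ _
  have hκ₂' : 1 / Real.log (1 / δ₀) ≤ κ₂ := le_max_right _ _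
  refine ⟨840 * (κ₁ * κ₂), by positivity,
    fun d T K ε δ β Q hT hK hε hεε₀ hδ hδδ₀ hβ hβ1 hQ => ?_⟩
  have hT1 : (1 : ℝ) ≤ T := by exact_mod_cast hT
  have hL : 0 < Real.log (T / β) := Real.log_pos (by rw [lt_div_iff₀ hβ]; linarith)
  have hDD : Real.log (1 / δ₀) ≤ Real.log (1 / δ) :=
    Real.log_le_log (by positivity) (one_div_le_one_div_of_le hδ hδδ₀)
  have hD : 0 < Real.log (1 / δ) := by linarith
  have hδD : Real.exp (-Real.log (1 / δ)) = δ := by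
    rw [Real.exp_neg, Real.exp_log (by positivity)]; simp
  set D := Real.log (1 / δ)
  set L := Real.log (T / β) with hLdef
  have hDκ : max 1 D ≤ κ₂ * D := by
    refine max_le ?_ (le_mul_of_one_le_left hD.le hκ₂)
    calc (1 : ℝ) = 1 / Real.log (1 / δ₀) * Real.log (1 / δ₀) := by field_simp
      _ ≤ κ₂ * D := by gcongr
  obtain ⟨A, hA, hA'⟩ := exists_approx_algorithm (Q := Q) (K := K) (ε := ε / κ₁) (D := max 1 D)
    hT hK (by positivity) (by rw [div_le_iff₀ (by positivity)]; linarith) (le_max_left _ _) hβ hβ1 hQ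
  refine ⟨A, hA.mono (div_le_self hε.le hκ₁) ?_, fun x hx => (hA' x hx).mono ?_⟩
  · rw [← hδD]
    exact Real.exp_le_exp.mpr (neg_le_neg (le_max_right _ _))
  rw [← hLdef, mul_assoc (840 : ℝ), inv_div]
  refine mul_le_mul_of_nonneg_left ?_ (by norm_num : (0 : ℝ) ≤ 840)
  have hκ : 1 ≤ κ₁ * κ₂ := by nlinarith
  have hκ0 : 0 ≤ κ₁ * κ₂ := by positivity
  rw [mul_min_of_nonneg _ _ hκ0, mul_min_of_nonneg _ _ hκ0]
  have hmax : (0 : ℝ) ≤ max 1 D := by positivity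
  refine min_le_min (le_mul_of_one_le_left hK hκ) (min_le_min ?_ ?_)
  · refine rpow_one_third_le (by positivity) (by positivity) (by positivity) ?_
    calc (κ₁ / ε) ^ 2 * K * max 1 D * L ^ 2
        ≤ (κ₁ / ε) ^ 2 * K * (κ₂ * D) * L ^ 2 := by gcongr
      _ = (κ₁ ^ 2 * κ₂) * (ε⁻¹ ^ 2 * K * D * L ^ 2) := by field_simp
      _ ≤ (κ₁ * κ₂) ^ 3 * (ε⁻¹ ^ 2 * K * D * L ^ 2) := by
          gcongr
          calc κ₁ ^ 2 * κ₂ = (κ₁ ^ 2 * κ₂) * (1 * 1) := by ring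
            _ ≤ (κ₁ ^ 2 * κ₂) * (κ₁ * κ₂ ^ 2) := by
                gcongr
                exact one_le_pow₀ hκ₂
            _ = (κ₁ * κ₂) ^ 3 := by ring
  · calc κ₁ / ε * Real.sqrt (T * max 1 D * L)
        ≤ κ₁ / ε * Real.sqrt (κ₂ ^ 2 * (T * D * L)) := by
          refine mul_le_mul_of_nonneg_left (Real.sqrt_le_sqrt ?_) (by positivity)
          calc T * max 1 D * L ≤ T * (κ₂ * D) * L := by gcongr
            _ = κ₂ * (T * D * L) := by ring
            _ ≤ κ₂ ^ 2 * (T * D * L) :=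
                mul_le_mul_of_nonneg_right (by nlinarith) (by positivity)
      _ = κ₁ * κ₂ * (ε⁻¹ * Real.sqrt (T * D * L)) := by
          rw [Real.sqrt_mul (by positivity), Real.sqrt_sq (by positivity)]
          ring
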